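/- Let $S^1=\mathbb R/2\pi\mathbb Z$, let $C(S^1)$ act on $L^2(S^1)$ (normalized Haar measure) by pointwise multiplication, put $e_k(x)=e^{ikx}$ for $k\in\mathbb Z$, and let $D=-i\,\frac{d}{dx}$ be the self-adjoint operator in $L^2(S^1)$ with $De_k=ke_k$. For $n\ge 1$ let $P_n$ be the orthogonal projection of $L^2(S^1)$ onto $\mathrm{span}_{\mathbb C}\{e_1,\dots,e_n\}$, and let $C(S^1)^{(n)}=P_nC(S^1)P_n\subseteq\mathcal B(P_nL^2(S^1))$ be the Toeplitz operator system. A state on an operator system $E\subseteq\mathcal B(\mathcal H)$ (a $*$-closed subspace containing $1$) is a linear functional on $E$ that is positive (on those elements of $E$ that are positive operators on $\mathcal H$) and has norm $1$; $\mathcal S(E)$ denotes the set of states. Define Connes' distances $$d_n(\varphi,\psi)=\sup\{|\varphi(T)-\psi(T)| : T\in C(S^1)^{(n)},\ \|[P_nDP_n,T]\|\le 1\},\qquad \varphi,\psi\in\mathcal S(C(S^1)^{(n)}),$$ $$d(\varphi,\psi)=\sup\{|\varphi(f)-\psi(f)| : f\in C^\infty(S^1),\ \|[D,f]\|\le 1\},\qquad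 \varphi,\psi\in\mathcal S(C(S^1)).$$ Then $d_n$ (for every $n\ge1$) and $d$ are finite metrics that induce the weak-$*$ topologies on the respective state spaces, so that $(\mathcal S(C(S^1)^{(n)}),d_n)$ and $(\mathcal S(C(S^1)),d)$ are nonempty compact metric spaces, and $$\lim_{n\to\infty} d_{\mathrm{GH}}\big((\mathcal S(C(S^1)^{(n)}),d_n),\,(\mathcal S(C(S^1)),d)\big)=0,$$ where $d_{\mathrm{GH}}$ is the Gromov–Hausdorff distance. -/

import Mathlib

open MeasureTheory Filter Topology
open scoped ENNReal NNReal ContDiff ComplexOrder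

noncomputable section

/-! ### Operator systems, states, and Connes' distance -/

section General

variable {H : Type*} [NormedAddCommGroup H] [InnerProductSpace ℂ H] [CompleteSpace H]

/-- A (concrete) operator system: a `*`-closed subspace of `B(H)` containing the identity. -/
structure OperatorSystem (H : Type*) [NormedAddCommGroup H] [InnerProductSpace ℂ H]
    [CompleteSpace H] where
  carrier : Submodule ℂ (H →L[ℂ] H)
  one_mem : (1 : H →L[ℂ] H) ∈ carrier
  star_mem : ∀ T ∈ carrier, star T ∈ carrier

/-- A state on an operator system `E ⊆ B(H)`: a positive linear functional of norm `1`, where `E`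
carries the operator norm and the order of `B(H)`. -/
@[ext]
structure OperatorSystem.State (E : OperatorSystem H) where
  toFunctional : E.carrier →L[ℂ] ℂ
  nonneg : ∀ T : E.carrier, (T : H →L[ℂ] H).IsPositive → 0 ≤ toFunctional T
  norm_eq_one : ‖toFunctional‖ = 1

/-- The weak-`*` topology on the state space: the topology of pointwise convergence on `E`. -/
@[reducible]
def OperatorSystem.weakStarTopology (E : OperatorSystem H) : TopologicalSpace E.State :=
  TopologicalSpace.induced (fun (φ : E.State) (T : E.carrier) => φ.toFunctional T)
    Pi.topologicalSpace

/-- The commutator `[D, T] = D T - T D`, for `D` a possibly unbounded operator, is defined on the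
whole domain of `D` and is bounded there by the constant `C`. -/
def CommutatorBound (D : H →ₗ.[ℂ] H) (T : H →L[ℂ] H) (C : ℝ≥0) : Prop :=
  ∀ ξ : D.domain, ∃ h : T (ξ : H) ∈ D.domain,
    ‖D ⟨T (ξ : H), h⟩ - T (D ξ)‖ ≤ C * ‖(ξ : H)‖

/-- The Lipschitz semi-norm `‖T‖₁ = ‖[D, T]‖`, the operator norm of the commutator; it is `∞` if
the commutator is not bounded. -/
def lipSeminorm (D : H →ₗ.[ℂ] H) (T : H →L[ℂ] H) : ℝ≥0∞ :=
  ⨅ (C : ℝ≥0) (_ : CommutatorBound D T C), (C : ℝ≥0∞)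

/-- Connes' distance on the states of the operator system `E`, relative to the subspace `A` of `E`
(the smooth elements) and the operator `D`:
`d(φ, ψ) = sup {|φ(T) - ψ(T)| : T ∈ A, ‖[D, T]‖ ≤ 1}`. -/
def OperatorSystem.connesDist (E : OperatorSystem H) (A : Submodule ℂ (H →L[ℂ] H))
    (D : H →ₗ.[ℂ] H) (φ ψ : E.State) : ℝ≥0∞ :=
  ⨆ (T : E.carrier) (_ : (T : H →L[ℂ] H) ∈ A) (_ : lipSeminorm D (T : H →L[ℂ] H) ≤ 1),
    ‖φ.toFunctional T - ψ.toFunctional T‖ₑ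

/-- The compression `T ↦ P T P`, as a map `B(H) → B(P H)`, where `P` is the orthogonal projection
onto `K`. -/
def compressL (K : Submodule ℂ H) [K.HasOrthogonalProjection] :
    (H →L[ℂ] H) →ₗ[ℂ] (K →L[ℂ] K) where
  toFun T := K.orthogonalProjectionOnto ∘L T ∘L K.subtypeL
  map_add' S T := by ext; simp
  map_smul' c T := by ext; simp

/-- The truncation `P D P` of a possibly unbounded operator `D` on `H`, as an operator on `P H = K`
with domain `K ∩ Dom D`. -/
def compressUnbounded (D : H →ₗ.[ℂ] H) (K : Submodule ℂ H) [K.HasOrthogonalProjection] :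
    K →ₗ.[ℂ] K where
  domain := D.domain.comap K.subtype
  toFun :=
    { toFun := fun ξ => K.orthogonalProjectionOnto (D ⟨((ξ : K) : H), ξ.2⟩)
      map_add' := fun ξ η => by
        rw [← map_add, ← LinearPMap.map_add]
        rfl
      map_smul' := fun c ξ => by
        rw [RingHom.id_apply, ← map_smul, ← LinearPMap.map_smul]
        rfl }

end General

/-! ### The circle -/

instance fact_zero_lt_two_pi : Fact (0 < 2 * Real.pi) := ⟨Real.two_pi_pos⟩

/-- The circle `S¹ = ℝ / 2πℤ`. -/
abbrev S1 : Type := AddCircle (2 * Real.pi)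

/-- The Hilbert space `L²(S¹)`, for the normalized Haar measure, so that the functions
`e_k(x) = exp (i k x)` form an orthonormal basis. -/
abbrev L2S1 : Type := Lp ℂ 2 (AddCircle.haarAddCircle (T := 2 * Real.pi))

/-- The representation of `C(S¹)` on `L²(S¹)` by pointwise multiplication. -/
def mulRep : C(S1, ℂ) →ₗ[ℂ] (L2S1 →L[ℂ] L2S1) :=
  ((ContinuousLinearMap.mul ℂ ℂ).holderL
      (AddCircle.haarAddCircle (T := 2 * Real.pi)) ∞ 2 2).toLinearMap ∘ₗ
    (ContinuousMap.toLp (E := ℂ) ∞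
      (AddCircle.haarAddCircle (T := 2 * Real.pi)) ℂ).toLinearMap

theorem coeFn_mulRep (f : C(S1, ℂ)) (ξ : L2S1) :
    (mulRep f ξ : S1 → ℂ) =ᵐ[AddCircle.haarAddCircle] fun x => f x * ξ x := by
  have h1 := (ContinuousLinearMap.mul ℂ ℂ).coeFn_holder (r := 2)
    (ContinuousMap.toLp (E := ℂ) ∞ (AddCircle.haarAddCircle (T := 2 * Real.pi)) ℂ f) ξ
  have h2 := ContinuousMap.coeFn_toLp (p := ∞) (𝕜 := ℂ)
    (AddCircle.haarAddCircle (T := 2 * Real.pi)) f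
  filter_upwards [h1, h2] with x hx1 hx2
  refine Eq.trans hx1 ?_
  rw [hx2]
  rfl

theorem mulRep_one : mulRep 1 = 1 := by
  ext1 ξ
  apply Lp.ext
  filter_upwards [coeFn_mulRep 1 ξ] with x hx
  rw [hx]
  simp

theorem star_mulRep (f : C(S1, ℂ)) : star (mulRep f) = mulRep (star f) := by
  rw [ContinuousLinearMap.star_eq_adjoint, eq_comm, ContinuousLinearMap.eq_adjoint_iff]
  intro ξ η
  rw [L2.inner_def, L2.inner_def]
  apply integral_congr_ae
  filter_upwards [coeFn_mulRep (star f) ξ, coeFn_mulRep f η] with x hx1 hx2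
  rw [hx1, hx2]
  simp
  ring

/-- `C(S¹)`, as an operator system in `B(L²(S¹))`. -/
def circleSystem : OperatorSystem L2S1 where
  carrier := LinearMap.range mulRep
  one_mem := ⟨1, mulRep_one⟩
  star_mem := by
    rintro _ ⟨f, rfl⟩
    exact ⟨star f, (star_mulRep f).symm⟩

/-- The smooth functions on the circle. -/
def smoothFunctions : Submodule ℂ C(S1, ℂ) where
  carrier := {f | ContDiff ℝ ∞ fun t : ℝ => f (t : S1)}
  add_mem' {f g} hf hg := by
    rw [Set.mem_ofPred_eq] at hf hg ⊢
    exact hf.add hg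
  zero_mem' := by
    rw [Set.mem_ofPred_eq]
    exact contDiff_const
  smul_mem' c f hf := by
    rw [Set.mem_ofPred_eq] at hf ⊢
    exact contDiff_const.smul hf

/-- `C^∞(S¹)`, acting on `L²(S¹)` by multiplication. -/
def circleSmooth : Submodule ℂ (L2S1 →L[ℂ] L2S1) := smoothFunctions.map mulRep

/-- The sequence `k ↦ k ξ_k`, where the `ξ_k` are the Fourier coefficients of `ξ ∈ L²(S¹)`. -/
def diracSeq : L2S1 →ₗ[ℂ] (ℤ → ℂ) where
  toFun ξ k := (k : ℂ) * fourierBasis.repr ξ k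
  map_add' ξ η := by
    funext k
    simp [mul_add]
  map_smul' c ξ := by
    funext k
    simp only [map_smul, lp.coeFn_smul, Pi.smul_apply, smul_eq_mul, RingHom.id_apply]
    ring

/-- The domain of `-i d/dx`: the `ξ ∈ L²(S¹)` with `∑ k² |ξ_k|² < ∞`, for the Fourier coefficients
`ξ_k` of `ξ`. -/
def diracDomain : Submodule ℂ L2S1 where
  carrier := {ξ | Memℓp (diracSeq ξ) 2}
  add_mem' {ξ η} hξ hη := by
    rw [Set.mem_ofPred_eq] at hξ hη ⊢
    rw [map_add]
    exact hξ.add hη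
  zero_mem' := by
    rw [Set.mem_ofPred_eq, map_zero]
    exact zero_memℓp
  smul_mem' c ξ hξ := by
    rw [Set.mem_ofPred_eq] at hξ ⊢
    rw [map_smul]
    exact hξ.const_smul c

/-- The sequence `k ↦ k ξ_k`, as an element of `ℓ²(ℤ)`, for `ξ` in the domain of `-i d/dx`. -/
def diracSeqL2 : diracDomain →ₗ[ℂ] lp (fun _ : ℤ => ℂ) 2 where
  toFun ξ := ⟨diracSeq (ξ : L2S1), ξ.2⟩
  map_add' ξ η := by
    ext k
    simp only [Submodule.coe_add, map_add, lp.coeFn_add]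
  map_smul' c ξ := by
    ext k
    simp

/-- The self-adjoint operator `D = -i d/dx` in `L²(S¹)`: it is diagonal in the basis
`e_k(x) = exp (i k x)` with `D e_k = k e_k`, on its maximal domain. -/
def circleDirac : L2S1 →ₗ.[ℂ] L2S1 where
  domain := diracDomain
  toFun := (fourierBasis (T := 2 * Real.pi)).repr.symm.toLinearEquiv.toLinearMap ∘ₗ diracSeqL2

/-- On continuously differentiable functions, `circleDirac` is `-i d/dx`. -/
theorem circleDirac_apply_of_hasDerivAt (f g : C(S1, ℂ))
    (hfg : ∀ t : ℝ, HasDerivAt (fun s : ℝ => f (s : S1)) (g (t : S1)) t) :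
    ∃ h : ContinuousMap.toLp (E := ℂ) 2 AddCircle.haarAddCircle ℂ f ∈ circleDirac.domain,
      circleDirac ⟨ContinuousMap.toLp (E := ℂ) 2 AddCircle.haarAddCircle ℂ f, h⟩ =
        ContinuousMap.toLp (E := ℂ) 2 AddCircle.haarAddCircle ℂ (-Complex.I • g) := by
  have key : diracSeq (ContinuousMap.toLp (E := ℂ) 2 AddCircle.haarAddCircle ℂ f) =
      fourierBasis.repr
        (ContinuousMap.toLp (E := ℂ) 2 AddCircle.haarAddCircle ℂ (-Complex.I • g)) := by
    funext k
    change (k : ℂ) * fourierBasis.repr _ k = _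
    rw [fourierBasis_repr, fourierBasis_repr, fourierCoeff_toLp, fourierCoeff_toLp,
      fourierCoeff_eq_intervalIntegral _ _ 0, fourierCoeff_eq_intervalIntegral _ _ 0, zero_add]
    have hc : ∀ u : C(S1, ℂ), Continuous fun t : ℝ => u (t : S1) :=
      fun u => u.continuous.comp (AddCircle.continuous_mk' _)
    have hd : ∀ t : ℝ, HasDerivAt (fun s : ℝ => fourier (-k) (s : S1) * f (s : S1))
        (-Complex.I * k * (fourier (-k) (t : S1) * f (t : S1))
          + fourier (-k) (t : S1) * g (t : S1)) t := by
      intro t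
      have h1 := (hasDerivAt_fourier_neg (2 * Real.pi) k t).mul (hfg t)
      refine h1.congr_deriv ?_
      have : (Real.pi : ℂ) ≠ 0 := by exact_mod_cast Real.pi_ne_zero
      push_cast
      field_simp
    have hF : Continuous fun t : ℝ => fourier (-k) (t : S1) * f (t : S1) :=
      (hc _).mul (hc f)
    have hG : Continuous fun t : ℝ => fourier (-k) (t : S1) * g (t : S1) :=
      (hc _).mul (hc g)
    have hint := intervalIntegral.integral_eq_sub_of_hasDerivAt (a := 0) (b := 2 * Real.pi)
      (fun t _ => hd t)
      (((continuous_const.mul hF).add hG).intervalIntegrable _ _)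
    have hK : Continuous fun t : ℝ => -Complex.I * k * (fourier (-k) (t : S1) * f (t : S1)) :=
      continuous_const.mul hF
    rw [intervalIntegral.integral_add (hK.intervalIntegrable _ _)
      (hG.intervalIntegrable _ _), intervalIntegral.integral_const_mul] at hint
    have hper : ((2 * Real.pi : ℝ) : S1) = ((0 : ℝ) : S1) := by
      simp
    rw [hper, sub_self] at hint
    have hR : (∫ t in (0 : ℝ)..(2 * Real.pi),
        fourier (-k) (t : S1) • (-Complex.I • g) (t : S1)) =
        -Complex.I * ∫ t in (0 : ℝ)..(2 * Real.pi), fourier (-k) (t : S1) * g (t : S1) := by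
      rw [← intervalIntegral.integral_const_mul]
      congr 1
      funext t
      simp only [ContinuousMap.smul_apply, smul_eq_mul]
      ring
    rw [hR]
    simp only [smul_eq_mul, Complex.real_smul]
    have hI := Complex.I_sq
    linear_combination Complex.I * ((1 / (2 * Real.pi) : ℝ) : ℂ) * hint
      + ((1 / (2 * Real.pi) : ℝ) : ℂ) * k *
        (∫ t in (0 : ℝ)..(2 * Real.pi), fourier (-k) (t : S1) * f (t : S1)) * hI
  have hmem : ContinuousMap.toLp (E := ℂ) 2 AddCircle.haarAddCircle ℂ f ∈ diracDomain := by
    change Memℓp (diracSeq _) 2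
    rw [key]
    exact lp.memℓp _
  refine ⟨hmem, ?_⟩
  change fourierBasis.repr.symm (diracSeqL2 ⟨_, hmem⟩) = _
  rw [LinearIsometryEquiv.symm_apply_eq]
  ext k
  exact congrFun key k

/-! ### Spectral truncations of the circle -/

/-- The space `P_n L²(S¹)`, spanned by `e_1, …, e_n`. -/
def truncSpace (n : ℕ) : Submodule ℂ L2S1 :=
  Submodule.span ℂ (Set.range fun j : Fin n => fourierLp (T := 2 * Real.pi) 2 ((j : ℤ) + 1))

instance truncSpace_finiteDimensional (n : ℕ) : FiniteDimensional ℂ (truncSpace n) :=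
  FiniteDimensional.span_of_finite ℂ (Set.finite_range _)

instance truncSpace_completeSpace (n : ℕ) : CompleteSpace (truncSpace n) :=
  FiniteDimensional.complete ℂ _

/-- The Toeplitz operator system `P_n C(S¹) P_n` in `B(P_n L²(S¹))`. -/
def toeplitzSystem (n : ℕ) : OperatorSystem (truncSpace n) where
  carrier := circleSystem.carrier.map (compressL (truncSpace n))
  one_mem := by
    refine ⟨1, circleSystem.one_mem, ?_⟩
    ext1 ξ
    exact Submodule.orthogonalProjectionOnto_mem_subspace_eq_self ξ
  star_mem := by
    rintro _ ⟨T, hT, rfl⟩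
    refine ⟨star T, circleSystem.star_mem T hT, ?_⟩
    rw [ContinuousLinearMap.star_eq_adjoint, ContinuousLinearMap.star_eq_adjoint,
      ContinuousLinearMap.eq_adjoint_iff]
    intro ξ η
    refine (Submodule.inner_orthogonalProjectionOnto_eq_of_mem_right η _).trans ?_
    refine Eq.trans ?_ (Submodule.inner_orthogonalProjectionOnto_eq_of_mem_left ξ _).symm
    exact ContinuousLinearMap.adjoint_inner_left T (η : L2S1) (ξ : L2S1)

/-- The truncated Dirac operator `P_n D P_n` on `P_n L²(S¹)`. -/
def truncDirac (n : ℕ) : truncSpace n →ₗ.[ℂ] truncSpace n :=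
  compressUnbounded circleDirac (truncSpace n)

theorem truncSpace_le_domain (n : ℕ) : truncSpace n ≤ circleDirac.domain := by
  refine Submodule.span_le.2 ?_
  rintro _ ⟨j, rfl⟩
  obtain ⟨h, -⟩ := circleDirac_apply_of_hasDerivAt (fourier ((j : ℤ) + 1))
    ((Complex.I * ((j : ℤ) + 1 : ℤ)) • fourier ((j : ℤ) + 1)) (fun t => by
      refine (hasDerivAt_fourier (2 * Real.pi) ((j : ℤ) + 1) t).congr_deriv ?_
      have : (Real.pi : ℂ) ≠ 0 := by exact_mod_cast Real.pi_ne_zero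
      simp only [ContinuousMap.smul_apply, smul_eq_mul]
      push_cast
      field_simp)
  exact h

theorem truncDirac_domain (n : ℕ) : (truncDirac n).domain = ⊤ :=
  Submodule.comap_subtype_eq_top.2 (truncSpace_le_domain n)

/-- Connes' distance on the state space of `C(S¹)`, for `(C^∞(S¹), L²(S¹), D)`. -/
def circleDist (φ ψ : circleSystem.State) : ℝ≥0∞ :=
  circleSystem.connesDist circleSmooth circleDirac φ ψ

/-- Connes' distance on the state space of the Toeplitz operator system, for
`(P_n C(S¹) P_n, P_n L²(S¹), P_n D P_n)`. -/
def toeplitzDist (n : ℕ) (φ ψ : (toeplitzSystem n).State) : ℝ≥0∞ :=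
  (toeplitzSystem n).connesDist (toeplitzSystem n).carrier (truncDirac n) φ ψ

end

/-! Two positive unital maps compare the two systems: the compression `R f = P_n f P_n` and, in the
other direction, the symbol `S`, which averages matrix entries along diagonals (`symbolMap`).
Evaluated at a point, `S` is a vector state of the matrix algebra (`symbolMap_apply`), so it is
positive, unital and contractive. Both maps are compatible with the commutators with `D`, hence send
Lipschitz balls into Lipschitz balls (`CommutatorBound.compress`, `CommutatorBound.symbol`), and
pulling back states along them gives 1-Lipschitz maps between the state spaces.

The composite `S R` is the Fejér mean `F_n` (`symbolMap_compressL`). Testing `[D, f]` on the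
constant function bounds the energy `∑ k² |f_k|²` on the Lipschitz ball, and Cauchy–Schwarz then
gives `‖f - F_n f‖ ≤ M γ_n` for functions of energy at most `M²`, where `γ_n = fejerRate n → 0`
(`EnergyLE.norm_sub_fejerMean_le`, `tendsto_fejerRate`). For `R S` the point is that only the energy
was used: a Toeplitz matrix in the Lipschitz ball is `R f` for some `f` of energy at most 2, read
off from two columns of its commutator (`energyLE_fourierPartialSum`). Hence the pullbacks are
mutually inverse up to `O(γ_n)`, and the Gromov–Hausdorff distance is at most `(√2 + 1) γ_n`
(`ghDist_le`).

The Fejér estimate also controls both distances, up to any error, by finitely many evaluations of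
states (`EnergyLE.norm_state_sub_le`). They are therefore finite and weak-* continuous, and
compactness of the state spaces identifies the topologies. -/

noncomputable section

/-! ### Positive functionals and weak-* compactness of the state space -/

section General

variable {H : Type*} [NormedAddCommGroup H] [InnerProductSpace ℂ H] [CompleteSpace H]

namespace OperatorSystem

/-- The unit of an operator system. -/
def unit (E : OperatorSystem H) : E.carrier := ⟨1, E.one_mem⟩

/-- The adjoint on an operator system. -/
def adj (E : OperatorSystem H) (T : E.carrier) : E.carrier :=
  ⟨star (T : H →L[ℂ] H), E.star_mem _ T.2⟩

/-- Cauchy–Schwarz bounds the quadratic form of `A` by `c ‖x‖²`. Adding a multiple of the unit stays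
inside an operator system, whereas the positive and negative parts of `A` might not. -/
theorem isPositive_real_smul_one_add {A : H →L[ℂ] H} (hA : IsSelfAdjoint A) {c : ℝ}
    (hc : ‖A‖ ≤ c) : ((c : ℂ) • (1 : H →L[ℂ] H) + A).IsPositive := by
  have hs : IsSelfAdjoint ((c : ℂ) • (1 : H →L[ℂ] H) + A) := by
    refine IsSelfAdjoint.add ?_ hA
    rw [isSelfAdjoint_iff, star_smul, star_one]
    simp
  rw [ContinuousLinearMap.isPositive_def']
  refine ⟨hs, fun x => ?_⟩
  have h1 : |RCLike.re (inner ℂ (A x) x)| ≤ c * ‖x‖ ^ 2 := by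
    refine (RCLike.abs_re_le_norm _).trans ((norm_inner_le_norm _ _).trans ?_)
    have := (A.le_opNorm x).trans (mul_le_mul_of_nonneg_right hc (norm_nonneg x))
    nlinarith [norm_nonneg x]
  have h2 : ContinuousLinearMap.reApplyInnerSelf ((c : ℂ) • (1 : H →L[ℂ] H) + A) x =
      c * ‖x‖ ^ 2 + RCLike.re (inner ℂ (A x) x) := by
    rw [ContinuousLinearMap.reApplyInnerSelf_apply]
    simp only [add_apply, smul_apply,
      one_apply_eq_self, inner_add_left, inner_smul_left, Complex.conj_ofReal, map_add]
    congr 1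
    rw [inner_self_eq_norm_sq_to_K]
    simp [← Complex.ofReal_pow, ← Complex.ofReal_mul]
  rw [h2]
  linarith [neg_le_of_abs_le h1]

variable {E : OperatorSystem H}

/-- A positive functional is real and bounded by its value at `1` on self-adjoint elements. -/
theorem norm_apply_le_of_isSelfAdjoint (φ : E.carrier →ₗ[ℂ] ℂ)
    (hφ : ∀ T : E.carrier, (T : H →L[ℂ] H).IsPositive → 0 ≤ φ T) (A : E.carrier)
    (hA : IsSelfAdjoint (A : H →L[ℂ] H)) :
    (φ A).im = 0 ∧ |(φ A).re| ≤ ‖A‖ * ‖φ E.unit‖ := by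
  have h0 : 0 ≤ φ E.unit := hφ _ ContinuousLinearMap.isPositive_one
  -- Positivity at `‖A‖ ± A` gives both signs of the bound in the real parts, and realness of `φ A`
  -- in the imaginary parts.
  have h1 : 0 ≤ φ (((‖A‖ : ℝ) : ℂ) • E.unit + A) :=
    hφ _ (isPositive_real_smul_one_add hA le_rfl)
  have h2 : 0 ≤ φ (((‖A‖ : ℝ) : ℂ) • E.unit + -A) :=
    hφ _ (isPositive_real_smul_one_add hA.neg (norm_neg (A : H →L[ℂ] H)).le)
  have hn : ‖φ E.unit‖ = (φ E.unit).re := by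
    have := Complex.eq_re_of_ofReal_le (r := 0) (by simpa using h0)
    rw [this]; simpa using (Complex.le_def.1 h0).1
  rw [map_add, map_smul] at h1 h2
  rw [map_neg] at h2
  rw [Complex.le_def] at h0 h1 h2
  simp only [Complex.zero_re, Complex.zero_im, smul_eq_mul, Complex.add_re, Complex.mul_re,
    Complex.ofReal_re, Complex.ofReal_im, zero_mul, sub_zero, Complex.add_im, Complex.mul_im,
    Complex.neg_re, Complex.neg_im, ← h0.2, mul_zero, add_zero, zero_add] at h0 h1 h2
  refine ⟨by linarith [h1.2], ?_⟩
  rw [hn, abs_le]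
  constructor <;> linarith

/-- After multiplying `T` by a phase, `φ T` is nonnegative. As `φ` is real on self-adjoint elements,
it then equals `φ` of the real part, whose norm is at most `‖T‖`; this keeps the constant equal to
1. -/
theorem norm_apply_le_of_nonneg (φ : E.carrier →ₗ[ℂ] ℂ)
    (hφ : ∀ T : E.carrier, (T : H →L[ℂ] H).IsPositive → 0 ≤ φ T) (T : E.carrier) :
    ‖φ T‖ ≤ ‖T‖ * ‖φ E.unit‖ := by
  obtain ⟨u, hu, huT⟩ : ∃ u : ℂ, ‖u‖ = 1 ∧ u * φ T = ‖φ T‖ := by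
    obtain ⟨u, hu, h⟩ := Complex.exists_norm_mul_eq_self (φ T)
    refine ⟨star u, by simpa using hu, ?_⟩
    have hs : star u * u = 1 := by
      rw [Complex.star_def, Complex.conj_mul', hu]; simp
    calc star u * φ T = star u * (u * ‖φ T‖) := by rw [h]
      _ = ‖φ T‖ := by rw [← mul_assoc, hs, one_mul]
  set B := u • T with hB
  have hBn : ‖B‖ = ‖T‖ := by rw [hB, norm_smul, hu, one_mul]
  have hBφ : φ B = ‖φ T‖ := by rw [hB, map_smul, smul_eq_mul, huT]
  set X := (1 / 2 : ℂ) • (B + E.adj B) with hX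
  set Y := (1 / 2 * Complex.I : ℂ) • (E.adj B - B) with hY
  have hXs : IsSelfAdjoint (X : H →L[ℂ] H) := by
    rw [isSelfAdjoint_iff]
    simp only [hX, adj, Submodule.coe_smul, Submodule.coe_add, star_smul, star_add, star_star]
    rw [add_comm]; simp
  have hYs : IsSelfAdjoint (Y : H →L[ℂ] H) := by
    rw [isSelfAdjoint_iff]
    simp only [hY, adj, Submodule.coe_smul, Submodule.coe_sub, star_smul, star_sub, star_star]
    rw [← neg_sub, smul_neg, ← neg_smul]; simp
  have hBXY : B = X + Complex.I • Y := by
    rw [hX, hY, smul_smul]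
    have : Complex.I * (1 / 2 * Complex.I) = -(1 / 2) := by
      linear_combination (1 / 2) * Complex.I_mul_I
    rw [this]
    module
  have hXn : ‖X‖ ≤ ‖T‖ := by
    have h1 : ‖E.adj B‖ = ‖B‖ := norm_star (B : H →L[ℂ] H)
    rw [hX, norm_smul]
    have := norm_add_le B (E.adj B)
    rw [h1, hBn] at this
    have h2 : ‖(1 / 2 : ℂ)‖ = 1 / 2 := by norm_num
    rw [h2]
    linarith
  obtain ⟨hx0, hx1⟩ := norm_apply_le_of_isSelfAdjoint φ hφ X hXs
  obtain ⟨hy0, -⟩ := norm_apply_le_of_isSelfAdjoint φ hφ Y hYs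
  have hre : ‖φ T‖ = (φ X).re := by
    have := congrArg Complex.re hBφ
    rw [hBXY] at this
    simp [hy0] at this
    exact this.symm
  rw [hre]
  exact (le_abs_self _).trans (hx1.trans (mul_le_mul_of_nonneg_right hXn (norm_nonneg _)))

namespace State

theorem norm_apply_le (φ : E.State) (T : E.carrier) : ‖φ.toFunctional T‖ ≤ ‖T‖ := by
  simpa [φ.norm_eq_one] using φ.toFunctional.le_opNorm T

theorem apply_unit (φ : E.State) : φ.toFunctional E.unit = 1 := by
  have h0 : 0 ≤ φ.toFunctional E.unit := φ.nonneg _ ContinuousLinearMap.isPositive_one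
  have hle : ‖φ.toFunctional‖ ≤ ‖φ.toFunctional E.unit‖ :=
    ContinuousLinearMap.opNorm_le_bound _ (norm_nonneg _) fun T => by
      rw [mul_comm]
      exact norm_apply_le_of_nonneg φ.toFunctional.toLinearMap φ.nonneg T
  have hge : ‖φ.toFunctional E.unit‖ ≤ 1 :=
    (φ.norm_apply_le _).trans (ContinuousLinearMap.norm_id_le (𝕜 := ℂ) (E := H))
  rw [φ.norm_eq_one] at hle
  rw [Complex.eq_coe_norm_of_nonneg h0, le_antisymm hge hle, Complex.ofReal_one]

/-- A positive linear functional with value `1` at `1` is a state. -/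
def ofPositive (φ : E.carrier →ₗ[ℂ] ℂ)
    (hφ : ∀ T : E.carrier, (T : H →L[ℂ] H).IsPositive → 0 ≤ φ T) (h1 : φ E.unit = 1) :
    E.State where
  toFunctional := φ.mkContinuous 1 fun T => by
    simpa [h1] using norm_apply_le_of_nonneg φ hφ T
  nonneg := hφ
  norm_eq_one := by
    refine le_antisymm (LinearMap.mkContinuous_norm_le _ zero_le_one _) ?_
    have hT := (φ.mkContinuous 1 fun T => by
      simpa [h1] using norm_apply_le_of_nonneg φ hφ T).le_opNorm E.unit
    have hT1 : (1 : ℝ) = ‖φ E.unit‖ := by rw [h1, norm_one]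
    refine hT1.trans_le (hT.trans (mul_le_of_le_one_right (norm_nonneg _) ?_))
    exact ContinuousLinearMap.norm_id_le (𝕜 := ℂ) (E := H)

/-- The vector state of a unit vector. -/
def ofVector (E : OperatorSystem H) (ξ : H) (hξ : ‖ξ‖ = 1) : E.State :=
  ofPositive
    { toFun := fun T => inner ℂ ξ ((T : H →L[ℂ] H) ξ)
      map_add' := fun S T => by simp
      map_smul' := fun c T => by simp }
    (fun _ hT => hT.inner_nonneg_right ξ)
    (by
      change inner ℂ ξ ξ = 1
      rw [inner_self_eq_norm_sq_to_K, hξ]; simp)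

end State

/-- Banach–Alaoglu. Norm one is not a weak-* closed condition, but for positive functionals it can
be traded for the value 1 at the unit, which is closed. -/
theorem compactSpace_state (E : OperatorSystem H) : @CompactSpace E.State E.weakStarTopology := by
  let _ := E.weakStarTopology
  let ι : E.State → WeakDual ℂ E.carrier := fun φ => StrongDual.toWeakDual φ.toFunctional
  have hind : IsInducing ι := by
    constructor
    change TopologicalSpace.induced _ _ = TopologicalSpace.induced ι (TopologicalSpace.induced _ _)
    exact (induced_compose (f := ι)
      (g := fun (φ : WeakDual ℂ E.carrier) (T : E.carrier) => φ T)).symm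
  have heval : ∀ T : E.carrier, Continuous fun φ : WeakDual ℂ E.carrier => φ T :=
    fun T => WeakDual.eval_continuous T
  have hrange : Set.range ι =
      (WeakDual.toStrongDual ⁻¹' Metric.closedBall (0 : StrongDual ℂ E.carrier) 1) ∩
        ((⋂ (T : E.carrier) (_ : (T : H →L[ℂ] H).IsPositive),
          {φ : WeakDual ℂ E.carrier | 0 ≤ φ T}) ∩ {φ | φ E.unit = 1}) := by
    ext φ
    constructor
    · rintro ⟨φ, rfl⟩
      refine ⟨?_, ?_, φ.apply_unit⟩
      · exact (mem_closedBall_zero_iff (E := StrongDual ℂ E.carrier)).2 φ.norm_eq_one.le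
      · exact Set.mem_iInter₂.2 φ.nonneg
    · rintro ⟨-, h2, h3⟩
      rw [Set.mem_iInter₂] at h2
      refine ⟨State.ofPositive (WeakDual.toStrongDual φ).toLinearMap h2 h3, ?_⟩
      exact DFunLike.ext _ _ fun T => rfl
  rw [← isCompact_univ_iff, hind.isCompact_iff, Set.image_univ, hrange]
  refine (WeakDual.isCompact_closedBall (𝕜 := ℂ) 0 1).inter_right (IsClosed.inter ?_ ?_)
  · exact isClosed_iInter fun T => isClosed_iInter fun _ =>
      isClosed_Ici.preimage (heval T)
  · exact isClosed_eq (heval _) continuous_const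

theorem topology_eq_of_compactSpace_of_t2Space {X : Type*} {s t : TopologicalSpace X}
    (hs : @CompactSpace X s) (ht : @T2Space X t) (hst : s ≤ t) : s = t := by
  refine le_antisymm hst (TopologicalSpace.le_def.2 fun U hU => ?_)
  have hc : @IsCompact X s Uᶜ :=
    @IsClosed.isCompact X s _ hs ((@isClosed_compl_iff X s U).2 hU)
  have hc' : @IsCompact X t (id '' Uᶜ) := @IsCompact.image X X s t _ _ hc (continuous_id_iff_le.2 hst)
  rw [Set.image_id] at hc'
  exact (@isClosed_compl_iff X t U).1 (@IsCompact.isClosed X t ht _ hc')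

/-! ### Connes' distance and the weak-* topology -/

section Metric

variable (A : Submodule ℂ (H →L[ℂ] H)) (D : H →ₗ.[ℂ] H)

theorem connesDist_self (φ : E.State) : E.connesDist A D φ φ = 0 := by
  simp [connesDist]

theorem connesDist_comm (φ ψ : E.State) : E.connesDist A D φ ψ = E.connesDist A D ψ φ := by
  simp only [connesDist, enorm_sub_rev]

theorem enorm_sub_le_connesDist {T : E.carrier} (hA : (T : H →L[ℂ] H) ∈ A)
    (hT : lipSeminorm D (T : H →L[ℂ] H) ≤ 1) (φ ψ : E.State) :
    ‖φ.toFunctional T - ψ.toFunctional T‖ₑ ≤ E.connesDist A D φ ψ :=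
  le_iSup_of_le T (le_iSup_of_le hA (le_iSup_of_le hT le_rfl))

theorem connesDist_triangle (φ ψ χ : E.State) :
    E.connesDist A D φ χ ≤ E.connesDist A D φ ψ + E.connesDist A D ψ χ := by
  refine iSup_le fun T => iSup_le fun hA => iSup_le fun hT => ?_
  refine le_trans ?_ (add_le_add (enorm_sub_le_connesDist A D hA hT φ ψ)
    (enorm_sub_le_connesDist A D hA hT ψ χ))
  rw [← sub_add_sub_cancel (φ.toFunctional T) (ψ.toFunctional T) (χ.toFunctional T)]
  exact enorm_add_le _ _

/-- The hypothesis `hfin` is the form in which total boundedness of the Lipschitz ball modulo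
constants enters: its right-hand side is weak-* continuous in `φ` and equals the error term at `φ =
φ₀`. -/
theorem tendsto_connesDist
    (hfin : ∀ ε : ℝ, 0 < ε → ∃ (F : Finset ℤ) (a : ℤ → E.carrier), ∀ φ ψ : E.State,
      E.connesDist A D φ ψ ≤
        ENNReal.ofReal (∑ k ∈ F, ‖φ.toFunctional (a k) - ψ.toFunctional (a k)‖ + ε)) (φ₀ : E.State) :
    Tendsto (fun φ => E.connesDist A D φ φ₀) (@nhds _ E.weakStarTopology φ₀) (𝓝 0) := by
  let _ := E.weakStarTopology
  have heval : ∀ T : E.carrier, Continuous fun φ : E.State => φ.toFunctional T := fun T =>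
    (continuous_apply T).comp continuous_induced_dom
  rw [ENNReal.tendsto_nhds_zero]
  intro ε hε
  obtain ⟨δ, hδ, hδε⟩ := ENNReal.lt_iff_exists_real_btwn.1 hε
  have hδ0 : 0 < δ := by simpa using hδε.1
  obtain ⟨F, a, hF⟩ := hfin (δ / 2) (half_pos hδ0)
  have hlim : Tendsto (fun φ : E.State =>
      ∑ k ∈ F, ‖φ.toFunctional (a k) - φ₀.toFunctional (a k)‖) (𝓝 φ₀) (𝓝 0) := by
    have : Continuous fun φ : E.State =>
        ∑ k ∈ F, ‖φ.toFunctional (a k) - φ₀.toFunctional (a k)‖ :=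
      continuous_finsetSum _ fun k _ => ((heval (a k)).sub continuous_const).norm
    simpa using this.tendsto φ₀
  filter_upwards [hlim.eventually (gt_mem_nhds (half_pos hδ0))] with φ hφ
  refine ((hF φ φ₀).trans (ENNReal.ofReal_le_ofReal ?_)).trans hδε.2.le
  linarith

/-- Connes' distance as an extended metric, when it separates states. -/
@[reducible]
def connesEMetricSpace (hsep : ∀ φ ψ : E.State, E.connesDist A D φ ψ = 0 → φ = ψ) :
    EMetricSpace E.State where
  edist := E.connesDist A D
  edist_self := connesDist_self A D
  edist_comm := connesDist_comm A D
  edist_triangle := connesDist_triangle A D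
  eq_of_edist_eq_zero h := hsep _ _ h

/-- Connes' distance as a metric, when it is finite and separates states. -/
@[reducible]
def connesMetricSpace (hsep : ∀ φ ψ : E.State, E.connesDist A D φ ψ = 0 → φ = ψ)
    (hne : ∀ φ ψ : E.State, E.connesDist A D φ ψ ≠ ⊤) : MetricSpace E.State :=
  @EMetricSpace.toMetricSpace _ (connesEMetricSpace A D hsep) hne

/-- Connes' distance is a metric inducing the weak-`*` topology when it separates states and is
controlled, up to any error, by finitely many evaluations. -/
theorem exists_metricSpace
    (hsep : ∀ φ ψ : E.State, E.connesDist A D φ ψ = 0 → φ = ψ)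
    (hfin : ∀ ε : ℝ, 0 < ε → ∃ (F : Finset ℤ) (a : ℤ → E.carrier), ∀ φ ψ : E.State,
      E.connesDist A D φ ψ ≤
        ENNReal.ofReal (∑ k ∈ F, ‖φ.toFunctional (a k) - ψ.toFunctional (a k)‖ + ε)) :
    ∃ m : MetricSpace E.State,
      (∀ φ ψ : E.State, m.toPseudoMetricSpace.edist φ ψ = E.connesDist A D φ ψ) ∧
      m.toUniformSpace.toTopologicalSpace = E.weakStarTopology := by
  have hne : ∀ φ ψ : E.State, E.connesDist A D φ ψ ≠ ⊤ := fun φ ψ => by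
    obtain ⟨F, a, hF⟩ := hfin 1 one_pos
    exact ne_top_of_le_ne_top ENNReal.ofReal_ne_top (hF φ ψ)
  let m : MetricSpace E.State := connesMetricSpace A D hsep hne
  refine ⟨m, fun φ ψ => rfl, ?_⟩
  -- The weak-* topology is compact and the metric one Hausdorff, so continuity of the identity in
  -- this one direction suffices.
  have hcont : @Continuous _ _ E.weakStarTopology m.toUniformSpace.toTopologicalSpace
      (Equiv.refl E.State) :=
    (@continuous_iff_continuousAt _ _ E.weakStarTopology _ _).2 fun φ₀ =>
      (tendsto_iff_edist_tendsto_0 (α := E.State)).2 (tendsto_connesDist A D hfin φ₀)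
  have hT2 : @T2Space E.State m.toUniformSpace.toTopologicalSpace := inferInstance
  exact (topology_eq_of_compactSpace_of_t2Space E.compactSpace_state hT2
    (continuous_id_iff_le.1 hcont)).symm

end Metric

end OperatorSystem

end General

/-! ### The Lipschitz unit ball -/

section General

variable {H : Type*} [NormedAddCommGroup H] [InnerProductSpace ℂ H]

theorem CommutatorBound.mono {D : H →ₗ.[ℂ] H} {T : H →L[ℂ] H} {C C' : ℝ≥0}
    (h : CommutatorBound D T C) (hC : C ≤ C') : CommutatorBound D T C' := fun ξ => by
  obtain ⟨hd, hle⟩ := h ξ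
  exact ⟨hd, hle.trans (mul_le_mul_of_nonneg_right (by exact_mod_cast hC) (norm_nonneg _))⟩

/-- The infimum is attained: bounds by every `r > 1` pass to the limit, and the domain condition
does not involve the constant. -/
theorem lipSeminorm_le_one_iff {D : H →ₗ.[ℂ] H} {T : H →L[ℂ] H} :
    lipSeminorm D T ≤ 1 ↔ CommutatorBound D T 1 := by
  constructor
  · intro h
    have key : ∀ r : ℝ≥0, 1 < r → CommutatorBound D T r := fun r hr => by
      have hlt : lipSeminorm D T < (r : ℝ≥0∞) := h.trans_lt (by exact_mod_cast hr)
      simp only [lipSeminorm, iInf_lt_iff] at hlt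
      obtain ⟨C, hC, hCr⟩ := hlt
      exact hC.mono (by exact_mod_cast hCr.le)
    intro ξ
    obtain ⟨hd, -⟩ := key 2 one_lt_two ξ
    refine ⟨hd, ?_⟩
    have hlim : Tendsto (fun r : ℝ≥0 => (r : ℝ) * ‖(ξ : H)‖) (𝓝[>] 1) (𝓝 ((1 : ℝ≥0) * ‖(ξ : H)‖)) :=
      ((NNReal.continuous_coe.mul continuous_const).tendsto _).mono_left nhdsWithin_le_nhds
    refine ge_of_tendsto hlim ?_
    filter_upwards [self_mem_nhdsWithin] with r hr
    exact (key r hr ξ).2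
  · exact fun h => iInf₂_le (1 : ℝ≥0) h

theorem lipSeminorm_smul_le_one {D : H →ₗ.[ℂ] H} {T : H →L[ℂ] H} {C : ℝ≥0}
    (h : CommutatorBound D T C) {c : ℂ} (hc : ‖c‖ * C ≤ 1) : lipSeminorm D (c • T) ≤ 1 := by
  refine lipSeminorm_le_one_iff.2 fun ξ => ?_
  obtain ⟨hd, hle⟩ := h ξ
  refine ⟨D.domain.smul_mem c hd, ?_⟩
  have h1 : D ⟨(c • T) (ξ : H), D.domain.smul_mem c hd⟩ = c • D ⟨T (ξ : H), hd⟩ :=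
    D.map_smul c ⟨T (ξ : H), hd⟩
  rw [h1, smul_apply, ← smul_sub, norm_smul]
  calc ‖c‖ * ‖D ⟨T (ξ : H), hd⟩ - T (D ξ)‖ ≤ ‖c‖ * (C * ‖(ξ : H)‖) := by gcongr
    _ = ‖c‖ * C * ‖(ξ : H)‖ := by ring
    _ ≤ 1 * ‖(ξ : H)‖ := by gcongr

end General

/-! ### Multiplication operators and their commutators with the Dirac operator -/

section Multiplication

theorem norm_mulRep_apply_le (f : C(S1, ℂ)) (ξ : L2S1) : ‖mulRep f ξ‖ ≤ ‖f‖ * ‖ξ‖ := by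
  refine Lp.norm_le_mul_norm_of_ae_le_mul ?_
  filter_upwards [coeFn_mulRep f ξ] with x hx
  rw [hx, norm_mul]
  exact mul_le_mul_of_nonneg_right (f.norm_coe_le_norm x) (norm_nonneg _)

theorem norm_mulRep_le (f : C(S1, ℂ)) : ‖mulRep f‖ ≤ ‖f‖ :=
  ContinuousLinearMap.opNorm_le_bound _ (norm_nonneg _) (norm_mulRep_apply_le f)

theorem isPositive_mulRep {f : C(S1, ℂ)} (hf : ∀ x, 0 ≤ f x) : (mulRep f).IsPositive := by
  rw [ContinuousLinearMap.isPositive_def']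
  constructor
  · rw [isSelfAdjoint_iff, star_mulRep]
    congr 1
    ext x
    exact (Complex.conj_eq_iff_im.2 (by simpa using (Complex.le_def.1 (hf x)).2.symm))
  · intro ξ
    rw [ContinuousLinearMap.reApplyInnerSelf_apply, L2.inner_def]
    have h1 : ∫ x, inner ℂ ((mulRep f ξ : S1 → ℂ) x) (ξ x) ∂AddCircle.haarAddCircle =
        ∫ x, (((f x).re * ‖ξ x‖ ^ 2 : ℝ) : ℂ) ∂AddCircle.haarAddCircle := by
      apply integral_congr_ae
      filter_upwards [coeFn_mulRep f ξ] with x hx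
      have hre : f x = ((f x).re : ℂ) := by
        apply Complex.ext
        · simp
        · simpa using (Complex.le_def.1 (hf x)).2.symm
      rw [hx, ← smul_eq_mul, inner_smul_left, inner_self_eq_norm_sq_to_K, hre]
      simp
    rw [h1, integral_complex_ofReal, RCLike.re_eq_complex_re, Complex.ofReal_re]
    refine integral_nonneg fun x => ?_
    have := (Complex.le_def.1 (hf x)).1
    simp only [Complex.zero_re] at this
    positivity

theorem repr_eq_integral (ξ : L2S1) (k : ℤ) :
    fourierBasis.repr ξ k = ∫ x, fourier (-k) x * ξ x ∂AddCircle.haarAddCircle := by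
  rw [fourierBasis_repr]
  rfl

theorem repr_mulRep_fourier (m : ℤ) (ξ : L2S1) (k : ℤ) :
    fourierBasis.repr (mulRep (fourier m) ξ) k = fourierBasis.repr ξ (k - m) := by
  rw [repr_eq_integral, repr_eq_integral]
  apply integral_congr_ae
  filter_upwards [coeFn_mulRep (fourier m) ξ] with x hx
  rw [hx, ← mul_assoc, ← fourier_add]
  congr 3
  ring

theorem repr_mulRep_fourierLp (f : C(S1, ℂ)) (j k : ℤ) :
    fourierBasis.repr (mulRep f (fourierLp 2 j)) k = fourierCoeff f (k - j) := by
  rw [repr_eq_integral]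
  apply integral_congr_ae
  filter_upwards [coeFn_mulRep f (fourierLp 2 j), coeFn_fourierLp 2 j] with x hx hx2
  rw [hx, hx2, smul_eq_mul, mul_left_comm, ← fourier_add, mul_comm]
  congr 3
  ring

theorem repr_fourierLp (j k : ℤ) :
    fourierBasis.repr (fourierLp (T := 2 * Real.pi) 2 j) k = if k = j then 1 else 0 := by
  have h : fourierLp (T := 2 * Real.pi) 2 j = fourierBasis j := by rw [coe_fourierBasis]
  rw [h, HilbertBasis.repr_self, lp.single_apply, Pi.single_apply]

theorem repr_circleDirac (ξ : circleDirac.domain) (k : ℤ) :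
    fourierBasis.repr (circleDirac ξ) k = k * fourierBasis.repr (ξ : L2S1) k := by
  change fourierBasis.repr (fourierBasis.repr.symm (diracSeqL2 ξ)) k = _
  rw [LinearIsometryEquiv.apply_symm_apply]
  rfl

theorem L2S1_ext {ξ η : L2S1} (h : ∀ k, fourierBasis.repr ξ k = fourierBasis.repr η k) : ξ = η :=
  fourierBasis.repr.injective (lp.ext (funext h))

theorem mem_domain_of_repr {ξ η : L2S1}
    (h : ∀ k : ℤ, k * fourierBasis.repr ξ k = fourierBasis.repr η k) : ξ ∈ circleDirac.domain := by
  change Memℓp (diracSeq ξ) 2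
  rw [show diracSeq ξ = fourierBasis.repr η from funext h]
  exact lp.memℓp _

/-- The commutator of `-i d/dx` with multiplication by `f` is multiplication by `g`. -/
def HasDiracCommutator (f g : C(S1, ℂ)) : Prop :=
  ∀ ξ : circleDirac.domain, ∃ h : mulRep f (ξ : L2S1) ∈ circleDirac.domain,
    circleDirac ⟨mulRep f (ξ : L2S1), h⟩ - mulRep f (circleDirac ξ) = mulRep g ξ

/-- Multiplication by `e_m` shifts Fourier coefficients by `m`, and `k = (k - m) + m`. With
linearity this covers trigonometric polynomials, in particular all symbols. -/
theorem hasDiracCommutator_fourier (m : ℤ) :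
    HasDiracCommutator (fourier m) ((m : ℂ) • fourier m) := by
  intro ξ
  have key : ∀ k : ℤ, k * fourierBasis.repr (mulRep (fourier m) (ξ : L2S1)) k =
      fourierBasis.repr (mulRep (fourier m) (circleDirac ξ) +
        (m : ℂ) • mulRep (fourier m) (ξ : L2S1)) k := fun k => by
    rw [map_add, map_smul, lp.coeFn_add, lp.coeFn_smul, Pi.add_apply, Pi.smul_apply,
      repr_mulRep_fourier, repr_mulRep_fourier, repr_circleDirac, smul_eq_mul]
    push_cast
    ring
  refine ⟨mem_domain_of_repr key, ?_⟩
  rw [sub_eq_iff_eq_add', map_smul, smul_apply]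
  refine L2S1_ext fun k => ?_
  rw [repr_circleDirac]
  exact key k

theorem HasDiracCommutator.add {f g f' g' : C(S1, ℂ)} (h : HasDiracCommutator f g)
    (h' : HasDiracCommutator f' g') : HasDiracCommutator (f + f') (g + g') := by
  intro ξ
  obtain ⟨hd, he⟩ := h ξ
  obtain ⟨hd', he'⟩ := h' ξ
  have hs : mulRep (f + f') (ξ : L2S1) = mulRep f ξ + mulRep f' ξ := by rw [map_add, add_apply]
  have hD : circleDirac (⟨mulRep f (ξ : L2S1), hd⟩ + ⟨mulRep f' (ξ : L2S1), hd'⟩) =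
      circleDirac ⟨mulRep f (ξ : L2S1), hd⟩ + circleDirac ⟨mulRep f' (ξ : L2S1), hd'⟩ :=
    circleDirac.map_add _ _
  refine ⟨hs ▸ circleDirac.domain.add_mem hd hd', ?_⟩
  simp only [map_add, add_apply]
  rw [← he, ← he', ← add_sub_add_comm]
  congr 1

theorem HasDiracCommutator.smul {f g : C(S1, ℂ)} (h : HasDiracCommutator f g) (c : ℂ) :
    HasDiracCommutator (c • f) (c • g) := by
  intro ξ
  obtain ⟨hd, he⟩ := h ξ
  have hD : circleDirac (c • ⟨mulRep f (ξ : L2S1), hd⟩) =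
      c • circleDirac ⟨mulRep f (ξ : L2S1), hd⟩ :=
    circleDirac.map_smul _ _
  have hs : mulRep (c • f) (ξ : L2S1) = c • mulRep f ξ := by rw [map_smul, smul_apply]
  refine ⟨hs ▸ circleDirac.domain.smul_mem c hd, ?_⟩
  simp only [map_smul, smul_apply]
  rw [← he, smul_sub]
  congr 1

theorem hasDiracCommutator_zero : HasDiracCommutator 0 0 := by
  simpa using (hasDiracCommutator_fourier 0).smul 0

theorem HasDiracCommutator.sum {ι : Type*} (s : Finset ι) {f g : ι → C(S1, ℂ)}
    (h : ∀ i ∈ s, HasDiracCommutator (f i) (g i)) :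
    HasDiracCommutator (∑ i ∈ s, f i) (∑ i ∈ s, g i) := by
  classical
  induction s using Finset.induction_on with
  | empty => simpa using hasDiracCommutator_zero
  | insert i s hi ih =>
    rw [Finset.sum_insert hi, Finset.sum_insert hi]
    exact (h i (Finset.mem_insert_self _ _)).add
      (ih fun j hj => h j (Finset.mem_insert_of_mem hj))

theorem HasDiracCommutator.commutatorBound {f g : C(S1, ℂ)} (h : HasDiracCommutator f g)
    {C : ℝ≥0} (hg : ‖g‖ ≤ C) : CommutatorBound circleDirac (mulRep f) C := by
  intro ξ
  obtain ⟨hd, he⟩ := h ξ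
  refine ⟨hd, ?_⟩
  rw [he]
  exact (norm_mulRep_apply_le g _).trans (mul_le_mul_of_nonneg_right hg (norm_nonneg _))

theorem fourierLp_mem_domain (j : ℤ) :
    fourierLp (T := 2 * Real.pi) 2 j ∈ circleDirac.domain := by
  refine mem_domain_of_repr (η := (j : ℂ) • fourierLp 2 j) fun k => ?_
  rw [map_smul, lp.coeFn_smul, Pi.smul_apply, repr_fourierLp]
  split_ifs with h <;> simp [h]

/-- The energy of a function with bounded commutator is bounded. -/
theorem CommutatorBound.sum_sq_fourierCoeff_le {f : C(S1, ℂ)}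
    (h : CommutatorBound circleDirac (mulRep f) 1) (s : Finset ℤ) :
    ∑ k ∈ s, ((k : ℝ) * ‖fourierCoeff f k‖) ^ 2 ≤ 1 := by
  -- On the constant function `e_0`, which `D` kills, the commutator is `D f`, with Fourier
  -- coefficients `k f_k`; Parseval does the rest.
  obtain ⟨hd, hle⟩ := h ⟨_, fourierLp_mem_domain 0⟩
  have h0 : circleDirac ⟨_, fourierLp_mem_domain 0⟩ = 0 := by
    refine L2S1_ext fun k => ?_
    rw [repr_circleDirac, repr_fourierLp]
    split_ifs with h <;> simp [h]
  have hn : ‖fourierLp (T := 2 * Real.pi) 2 0‖ = 1 := orthonormal_fourier.norm_eq_one 0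
  rw [h0, map_zero, sub_zero, hn] at hle
  set v := circleDirac ⟨_, hd⟩
  have hv : ∀ k : ℤ, ‖fourierBasis.repr v k‖ = |(k : ℝ)| * ‖fourierCoeff f k‖ := fun k => by
    rw [repr_circleDirac, repr_mulRep_fourierLp, norm_mul, sub_zero]
    simp
  have hb := lp.sum_rpow_le_norm_rpow (p := 2) (by norm_num) (fourierBasis.repr v) s
  simp only [ENNReal.toReal_ofNat, Real.rpow_two, hv, LinearIsometryEquiv.norm_map] at hb
  refine le_trans (le_of_eq (Finset.sum_congr rfl fun k _ => ?_)) (hb.trans ?_)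
  · rw [mul_pow, mul_pow, sq_abs]
  · have : ‖v‖ ≤ 1 := by simpa using hle
    nlinarith [norm_nonneg v]

theorem smooth_fourier (m : ℤ) : (fourier m : C(S1, ℂ)) ∈ smoothFunctions := by
  change ContDiff ℝ ∞ fun t : ℝ => (fourier m (t : S1) : ℂ)
  simp only [fourier_coe_apply]
  have : ContDiff ℝ ∞ fun t : ℝ => (t : ℂ) := Complex.ofRealCLM.contDiff
  fun_prop

/-- A function on the circle as an element of the operator system. -/
def circleElem : C(S1, ℂ) →ₗ[ℂ] circleSystem.carrier := mulRep.rangeRestrict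

theorem circleElem_surjective : Function.Surjective circleElem := mulRep.surjective_rangeRestrict

theorem norm_circleElem_le (f : C(S1, ℂ)) : ‖circleElem f‖ ≤ ‖f‖ := norm_mulRep_le f

theorem circleElem_one : circleElem 1 = circleSystem.unit := Subtype.ext mulRep_one

/-- States on the circle are determined by their values on the exponentials. -/
theorem circleState_ext {φ ψ : circleSystem.State}
    (h : ∀ k : ℤ, φ.toFunctional (circleElem (fourier k)) =
      ψ.toFunctional (circleElem (fourier k))) : φ = ψ := by
  let Φ : circleSystem.State → (C(S1, ℂ) →L[ℂ] ℂ) := fun χ =>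
    (χ.toFunctional.toLinearMap ∘ₗ circleElem).mkContinuous 1 fun f => by
      rw [one_mul]
      exact (χ.norm_apply_le _).trans (norm_circleElem_le f)
  have hΦ : Φ φ = Φ ψ := by
    refine ContinuousLinearMap.ext_on (s := Set.range (@fourier (2 * Real.pi))) ?_ ?_
    · rw [Submodule.dense_iff_topologicalClosure_eq_top]
      exact span_fourier_closure_eq_top
    · rintro _ ⟨k, rfl⟩
      exact h k
  ext T
  obtain ⟨f, rfl⟩ := circleElem_surjective T
  exact congrArg (fun χ : C(S1, ℂ) →L[ℂ] ℂ => χ f) hΦ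

/-- A nonzero multiple of each exponential lies in the Lipschitz ball, and exponentials span a dense
subspace. -/
theorem circleDist_separates {φ ψ : circleSystem.State} (h : circleDist φ ψ = 0) : φ = ψ := by
  refine circleState_ext fun k => ?_
  have hb : CommutatorBound circleDirac (mulRep (fourier k))
      ⟨‖(k : ℂ) • fourier (T := 2 * Real.pi) k‖, norm_nonneg _⟩ :=
    (hasDiracCommutator_fourier k).commutatorBound le_rfl
  set C : ℝ≥0 := ⟨‖(k : ℂ) • fourier (T := 2 * Real.pi) k‖, norm_nonneg _⟩
  -- The summand 1 keeps `c` nonzero and covers `k = 0`, where `C = 0`.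
  set c : ℂ := (((1 + C : ℝ≥0) : ℝ) : ℂ)⁻¹ with hc
  have hc0 : c ≠ 0 := by
    rw [hc]
    refine inv_ne_zero ?_
    rw [Complex.ofReal_ne_zero]
    positivity
  have hcC : ‖c‖ * C ≤ 1 := by
    rw [hc, norm_inv, Complex.norm_real, Real.norm_of_nonneg (NNReal.coe_nonneg _), inv_mul_le_one₀]
    · push_cast; linarith
    · positivity
  have hle := OperatorSystem.enorm_sub_le_connesDist (E := circleSystem) circleSmooth circleDirac
    (T := c • circleElem (fourier k)) (circleSmooth.smul_mem c ⟨_, smooth_fourier k, rfl⟩)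
    (lipSeminorm_smul_le_one hb hcC) φ ψ
  rw [show circleSystem.connesDist circleSmooth circleDirac φ ψ = 0 from h, nonpos_iff_eq_zero,
    enorm_eq_zero, map_smul, map_smul, ← smul_sub, smul_eq_zero, sub_eq_zero] at hle
  exact hle.resolve_left hc0

end Multiplication

/-! ### Fejér approximation of functions of bounded energy -/

section Estimate

/-- The defect `min (|k| / n) 1` of the `n`-th Fejér weight at `k`. -/
def fejerDefect (n : ℕ) (k : ℤ) : ℝ := min (|(k : ℝ)| / n) 1

theorem fejerDefect_nonneg (n : ℕ) (k : ℤ) : 0 ≤ fejerDefect n k :=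
  le_min (by positivity) zero_le_one

theorem fejerDefect_le_one (n : ℕ) (k : ℤ) : fejerDefect n k ≤ 1 := min_le_right _ _

theorem fejerDefect_zero (n : ℕ) : fejerDefect n 0 = 0 := by simp [fejerDefect]

theorem fejerDefect_one {k : ℤ} (hk : k ≠ 0) : fejerDefect 1 k = 1 := by
  have : (1 : ℝ) ≤ |(k : ℝ)| := by exact_mod_cast Int.one_le_abs hk
  simp [fejerDefect, this]

/-- A summable majorant independent of `n`, for dominated convergence. At `k = 0` both sides are 0,
by the convention for division by zero. -/
theorem sq_fejerDefect_div_le (n : ℕ) (k : ℤ) : (fejerDefect n k / k) ^ 2 ≤ 1 / (k : ℝ) ^ 2 := by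
  rw [div_pow]
  gcongr
  exact pow_le_one₀ (fejerDefect_nonneg n k) (fejerDefect_le_one n k)

theorem summable_one_div_int_sq : Summable fun k : ℤ => 1 / (k : ℝ) ^ 2 :=
  Real.summable_one_div_int_pow.2 one_lt_two

theorem summable_sq_fejerDefect_div (n : ℕ) : Summable fun k : ℤ => (fejerDefect n k / k) ^ 2 :=
  summable_one_div_int_sq.of_nonneg_of_le (fun _ => sq_nonneg _) (sq_fejerDefect_div_le n)

/-- The rate at which Fejér means approximate functions of bounded energy. -/
def fejerRate (n : ℕ) : ℝ := √(∑' k : ℤ, (fejerDefect n k / k) ^ 2)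

theorem fejerRate_nonneg (n : ℕ) : 0 ≤ fejerRate n := Real.sqrt_nonneg _

theorem tendsto_fejerRate : Tendsto fejerRate atTop (𝓝 0) := by
  have h : Tendsto (fun n : ℕ => ∑' k : ℤ, (fejerDefect n k / k) ^ 2) atTop
      (𝓝 (∑' _ : ℤ, (0 : ℝ))) := by
    refine tendsto_tsum_of_dominated_convergence summable_one_div_int_sq (fun k => ?_)
      (Eventually.of_forall fun n k => ?_)
    · have h1 : Tendsto (fun n : ℕ => fejerDefect n k) atTop (𝓝 0) :=
        squeeze_zero (fun n => fejerDefect_nonneg n k) (fun n => min_le_left _ _)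
          (tendsto_const_div_atTop_nhds_zero_nat _)
      simpa using (h1.div_const (k : ℝ)).pow 2
    · rw [Real.norm_of_nonneg (sq_nonneg _)]
      exact sq_fejerDefect_div_le n k
  rw [tsum_zero] at h
  have h2 := h.sqrt
  rw [Real.sqrt_zero] at h2
  exact h2

variable {f : C(S1, ℂ)} {M : ℝ}

/-- The energy `∑ k² |f_k|²` of `f` is at most `M²`. -/
def EnergyLE (f : C(S1, ℂ)) (M : ℝ) : Prop :=
  0 ≤ M ∧ ∀ s : Finset ℤ, ∑ k ∈ s, ((k : ℝ) * ‖fourierCoeff f k‖) ^ 2 ≤ M ^ 2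

theorem EnergyLE.norm_fourierCoeff_le (h : EnergyLE f M) {k : ℤ} (hk : k ≠ 0) :
    ‖fourierCoeff f k‖ ≤ M := by
  have h1 := h.2 {k}
  rw [Finset.sum_singleton, mul_pow] at h1
  have h2 : (1 : ℝ) ≤ (k : ℝ) ^ 2 := by
    exact_mod_cast one_le_sq_iff_one_le_abs _ |>.2 (Int.one_le_abs hk)
  refine abs_le_of_sq_le_sq' ?_ h.1 |>.2
  nlinarith [sq_nonneg ‖fourierCoeff f k‖]

/-- Cauchy–Schwarz for the factors `fejerDefect n k / k` and `k |f_k|`. Inserting `k / k` is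
harmless at `k = 0` because the defect vanishes there. -/
theorem EnergyLE.sum_fejerDefect_le (h : EnergyLE f M) (n : ℕ) (s : Finset ℤ) :
    ∑ k ∈ s, fejerDefect n k * ‖fourierCoeff f k‖ ≤ M * fejerRate n := by
  have h1 : ∀ k ∈ s, fejerDefect n k * ‖fourierCoeff f k‖ =
      (fejerDefect n k / k) * (k * ‖fourierCoeff f k‖) := fun k _ => by
    rcases eq_or_ne k 0 with rfl | hk
    · simp [fejerDefect_zero]
    · have : (k : ℝ) ≠ 0 := by exact_mod_cast hk
      field_simp
  rw [Finset.sum_congr rfl h1]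
  refine (Real.sum_mul_le_sqrt_mul_sqrt s _ _).trans ?_
  rw [mul_comm]
  refine mul_le_mul ?_ ?_ (Real.sqrt_nonneg _) h.1
  · exact Real.sqrt_le_iff.2 ⟨h.1, h.2 s⟩
  · exact Real.sqrt_le_sqrt
      ((summable_sq_fejerDefect_div n).sum_le_tsum s fun _ _ => sq_nonneg _)

theorem EnergyLE.summable_fejerDefect (h : EnergyLE f M) (n : ℕ) :
    Summable fun k : ℤ => fejerDefect n k * ‖fourierCoeff f k‖ :=
  summable_of_sum_le (fun k => mul_nonneg (fejerDefect_nonneg n k) (norm_nonneg _))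
    (h.sum_fejerDefect_le n)

/-- For `n = 1` the defect is 1 away from `k = 0`, so the weighted bound already says that the
Fourier series converges absolutely. -/
theorem EnergyLE.hasSum (h : EnergyLE f M) :
    HasSum (fun k : ℤ => fourierCoeff f k • fourier k) f := by
  refine hasSum_fourier_series_of_summable ?_
  refine Summable.of_norm ?_
  refine (h.summable_fejerDefect 1).congr_cofinite ?_
  filter_upwards [(Set.finite_singleton (0 : ℤ)).compl_mem_cofinite] with k hk
  rw [fejerDefect_one hk, one_mul]

/-- A sum over the entries of a Toeplitz matrix, sorted by diagonals. -/
theorem sum_sum_sub_eq {V : Type*} [AddCommGroup V] [Module ℂ V] (n : ℕ) (g : ℤ → V) :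
    ∑ j : Fin n, ∑ l : Fin n, g ((j : ℤ) - l) =
      ∑ k ∈ Finset.Ioo (-(n : ℤ)) n, ((n : ℂ) - |k|) • g k := by
  have h1 : ∀ u : ℤ → V, ∑ j : Fin n, u j = ∑ j ∈ Finset.Ico (0 : ℤ) n, u j := fun u => by
    rw [Fin.sum_univ_eq_sum_range (fun i : ℕ => u i) n]
    refine Finset.sum_nbij' (fun i => (i : ℤ)) Int.toNat ?_ ?_ ?_ ?_ ?_ <;> intro i hi <;>
      simp only [Finset.mem_range, Finset.mem_Ico] at hi ⊢ <;> omega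
  rw [h1 fun j => ∑ l : Fin n, g (j - l)]
  simp only [fun j : ℤ => h1 fun l => g (j - l)]
  rw [← Finset.sum_product', ← Finset.sum_fiberwise_of_maps_to (g := fun p : ℤ × ℤ => p.1 - p.2)
    (t := Finset.Ioo (-(n : ℤ)) n)]
  · refine Finset.sum_congr rfl fun k hk => ?_
    rw [Finset.sum_congr rfl fun p hp => by rw [(Finset.mem_filter.1 hp).2], Finset.sum_const]
    -- On the `k`-th diagonal the first coordinate determines the pair, and it runs over an interval
    -- with `n - |k|` elements.
    have hcard : Finset.card {p ∈ Finset.Ico (0 : ℤ) n ×ˢ Finset.Ico (0 : ℤ) n | p.1 - p.2 = k} =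
        Finset.card (Finset.Ico (max 0 k) (min (n : ℤ) (n + k))) := by
      refine Finset.card_nbij' (fun p => p.1) (fun a => (a, a - k)) ?_ ?_ ?_ ?_
      · rintro ⟨a, b⟩ h
        simp only [Finset.coe_filter, Finset.mem_product, Finset.mem_Ico, Set.mem_ofPred_eq,
          Finset.coe_Ico, Set.mem_Ico] at h ⊢
        omega
      · intro a h
        simp only [Finset.coe_filter, Finset.mem_product, Finset.mem_Ico, Set.mem_ofPred_eq,
          Finset.coe_Ico, Set.mem_Ico] at h ⊢
        omega
      · rintro ⟨a, b⟩ h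
        simp only [Finset.coe_filter, Finset.mem_product, Finset.mem_Ico, Set.mem_ofPred_eq,
          Prod.mk.injEq, true_and] at h ⊢
        omega
      · intro a _
        rfl
    rw [hcard, Int.card_Ico, ← Nat.cast_smul_eq_nsmul ℂ]
    congr 1
    rw [Finset.mem_Ioo] at hk
    have : ((min (n : ℤ) (n + k) - max 0 k).toNat : ℤ) = n - |k| := by
      rcases abs_cases k with h | h <;> omega
    exact_mod_cast congrArg (Int.cast : ℤ → ℂ) this
  · rintro ⟨a, b⟩ h
    simp only [Finset.mem_product, Finset.mem_Ico, Finset.mem_Ioo] at h ⊢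
    omega

theorem coeff_fejer {n : ℕ} (hn : 0 < n) {k : ℤ} (hk : k ∈ Finset.Ioo (-(n : ℤ)) n) :
    (1 / n : ℂ) * ((n : ℂ) - |k|) = ((1 - fejerDefect n k : ℝ) : ℂ) := by
  rw [Finset.mem_Ioo] at hk
  have h1 : |(k : ℝ)| ≤ n := by
    rw [abs_le]; constructor <;> [exact_mod_cast hk.1.le; exact_mod_cast hk.2.le]
  have hn' : (0 : ℝ) < n := by exact_mod_cast hn
  have hn'' : (n : ℂ) ≠ 0 := by exact_mod_cast hn.ne'
  rw [fejerDefect, min_eq_left ((div_le_one hn').2 h1)]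
  have h2 : ((|k| : ℤ) : ℂ) = ((|(k : ℝ)| : ℝ) : ℂ) := by
    rw [← Int.cast_abs]
    norm_cast
  rw [h2]
  push_cast
  field_simp

theorem fejerDefect_of_notMem {n : ℕ} (hn : 0 < n) {k : ℤ} (hk : k ∉ Finset.Ioo (-(n : ℤ)) n) :
    fejerDefect n k = 1 := by
  have hn' : (0 : ℝ) < n := by exact_mod_cast hn
  refine min_eq_right ((one_le_div hn').2 ?_)
  rw [Finset.mem_Ioo, ← abs_lt, not_lt] at hk
  exact_mod_cast hk

/-- The `n`-th Fejér mean of a function on the circle. -/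
def fejerMean (n : ℕ) (f : C(S1, ℂ)) : C(S1, ℂ) :=
  ∑ k ∈ Finset.Ioo (-(n : ℤ)) n, ((1 - fejerDefect n k : ℝ) : ℂ) • fourierCoeff f k • fourier k

/-- The Fejér weight `1 - fejerDefect n k` vanishes for `|k| ≥ n`, so the difference is the full
series `∑ fejerDefect n k • f_k e_k`, and exponentials have norm 1. -/
theorem EnergyLE.norm_sub_fejerMean_le (h : EnergyLE f M) {n : ℕ} (hn : 0 < n) :
    ‖f - fejerMean n f‖ ≤ M * fejerRate n := by
  have h1 : HasSum (fun k : ℤ => ((1 - fejerDefect n k : ℝ) : ℂ) • fourierCoeff f k •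
      (fourier k : C(S1, ℂ))) (fejerMean n f) := by
    refine hasSum_sum_of_ne_finset_zero fun k hk => ?_
    rw [fejerDefect_of_notMem hn hk]
    simp
  have h2 := h.hasSum.sub h1
  have h3 : ∀ k : ℤ, ‖fourierCoeff f k • (fourier k : C(S1, ℂ)) -
      ((1 - fejerDefect n k : ℝ) : ℂ) • fourierCoeff f k • (fourier k : C(S1, ℂ))‖ ≤
      fejerDefect n k * ‖fourierCoeff f k‖ := fun k => by
    have : fourierCoeff f k • (fourier k : C(S1, ℂ)) -
      ((1 - fejerDefect n k : ℝ) : ℂ) • fourierCoeff f k • (fourier k : C(S1, ℂ)) =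
      (fejerDefect n k : ℂ) • fourierCoeff f k • (fourier k : C(S1, ℂ)) := by
      push_cast
      module
    rw [this, norm_smul, norm_smul, fourier_norm, mul_one, Complex.norm_real,
      Real.norm_of_nonneg (fejerDefect_nonneg n k)]
  rw [← h2.tsum_eq]
  refine (tsum_of_norm_bounded (h.summable_fejerDefect n).hasSum h3).trans ?_
  exact (h.summable_fejerDefect n).tsum_le_of_sum_le (h.sum_fejerDefect_le n)

/-- Two states differ little on functions of bounded energy when they agree on few exponentials. -/
theorem EnergyLE.norm_state_sub_le (h : EnergyLE f M) {n : ℕ} (hn : 0 < n)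
    (φ ψ : circleSystem.State) :
    ‖φ.toFunctional (circleElem f) - ψ.toFunctional (circleElem f)‖ ≤
      ∑ k ∈ Finset.Ioo (-(n : ℤ)) n, ‖φ.toFunctional (circleElem ((M : ℂ) • fourier k)) -
        ψ.toFunctional (circleElem ((M : ℂ) • fourier k))‖ + 2 * (M * fejerRate n) := by
  set g := fejerMean n f with hg
  have hfg := h.norm_sub_fejerMean_le hn
  have hstate : ∀ χ : circleSystem.State,
      ‖χ.toFunctional (circleElem (f - g))‖ ≤ M * fejerRate n := fun χ =>
    (χ.norm_apply_le _).trans ((norm_circleElem_le _).trans hfg)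
  have hmain : ‖φ.toFunctional (circleElem g) - ψ.toFunctional (circleElem g)‖ ≤
      ∑ k ∈ Finset.Ioo (-(n : ℤ)) n, ‖φ.toFunctional (circleElem ((M : ℂ) • fourier k)) -
        ψ.toFunctional (circleElem ((M : ℂ) • fourier k))‖ := by
    simp only [hg, fejerMean, map_sum, map_smul, ← Finset.sum_sub_distrib, ← smul_sub, norm_smul,
      Complex.norm_real, Real.norm_of_nonneg h.1]
    refine norm_sum_le_of_le _ fun k _ => ?_
    simp only [norm_smul, Complex.norm_real]
    -- The energy says nothing about the mean value `f_0`, but all states agree on constants.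
    rcases eq_or_ne k 0 with rfl | hk
    · have h0 : (fourier 0 : C(S1, ℂ)) = 1 := ContinuousMap.ext fun _ => fourier_zero
      simp only [h0, circleElem_one, OperatorSystem.State.apply_unit, sub_self,
        norm_zero, mul_zero, le_refl]
    · have h1 : ‖1 - fejerDefect n k‖ ≤ 1 := by
        rw [Real.norm_of_nonneg (sub_nonneg.2 (fejerDefect_le_one n k))]
        linarith [fejerDefect_nonneg n k]
      calc _ ≤ 1 * (M * ‖φ.toFunctional (circleElem (fourier k)) -
          ψ.toFunctional (circleElem (fourier k))‖) := by
            gcongr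
            exact h.norm_fourierCoeff_le hk
        _ = _ := one_mul _
  have hdec : φ.toFunctional (circleElem f) - ψ.toFunctional (circleElem f) =
      (φ.toFunctional (circleElem g) - ψ.toFunctional (circleElem g)) +
      (φ.toFunctional (circleElem (f - g)) - ψ.toFunctional (circleElem (f - g))) := by
    simp only [map_sub]
    ring
  rw [hdec]
  refine (norm_add_le _ _).trans (add_le_add hmain ((norm_sub_le _ _).trans ?_))
  linarith [hstate φ, hstate ψ]

end Estimate

/-! ### Compression to the truncated space -/

section Truncation

variable {n : ℕ}

theorem fourierLp_mem_truncSpace (j : Fin n) :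
    fourierLp (T := 2 * Real.pi) 2 ((j : ℤ) + 1) ∈ truncSpace n :=
  Submodule.subset_span ⟨j, rfl⟩

/-- The orthonormal basis `e_1, …, e_n` of the truncated space. -/
def truncBasis (n : ℕ) : OrthonormalBasis (Fin n) ℂ (truncSpace n) :=
  OrthonormalBasis.mk (v := fun j => ⟨_, fourierLp_mem_truncSpace j⟩)
    (by
      have h : Orthonormal ℂ fun j : Fin n => fourierLp (T := 2 * Real.pi) 2 ((j : ℤ) + 1) :=
        orthonormal_fourier.comp _ fun i j hij => by
          have : (i : ℤ) = j := by simpa using hij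
          exact Fin.ext (by exact_mod_cast this)
      exact ((truncSpace n).subtypeₗᵢ.orthonormal_comp_iff).1 h)
    (by
      refine (Submodule.map_injective_of_injective (truncSpace n).injective_subtype ?_).ge
      rw [Submodule.map_span, Submodule.map_top, Submodule.range_subtype, ← Set.range_comp]
      rfl)

theorem coe_truncBasis (j : Fin n) :
    (truncBasis n j : L2S1) = fourierLp 2 ((j : ℤ) + 1) := by
  rw [truncBasis, OrthonormalBasis.coe_mk]

theorem repr_eq_inner (ξ : L2S1) (k : ℤ) :
    fourierBasis.repr ξ k = inner ℂ (fourierLp (T := 2 * Real.pi) 2 k) ξ := by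
  rw [HilbertBasis.repr_apply_apply, coe_fourierBasis]

theorem inner_truncBasis (j : Fin n) (ξ : truncSpace n) :
    inner ℂ (truncBasis n j) ξ = fourierBasis.repr (ξ : L2S1) (j + 1) := by
  rw [repr_eq_inner, ← coe_truncBasis, Submodule.coe_inner]

theorem inner_truncBasis_proj (j : Fin n) (v : L2S1) :
    inner ℂ (truncBasis n j) ((truncSpace n).orthogonalProjectionOnto v) =
      fourierBasis.repr v (j + 1) := by
  rw [repr_eq_inner, ← coe_truncBasis, Submodule.inner_orthogonalProjectionOnto_eq_of_mem_left]

theorem truncSpace_ext {ξ η : truncSpace n}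
    (h : ∀ j, inner ℂ (truncBasis n j) ξ = inner ℂ (truncBasis n j) η) : ξ = η :=
  (truncBasis n).repr.injective <| by
    ext j
    rw [(truncBasis n).repr_apply_apply, (truncBasis n).repr_apply_apply, h j]

theorem truncInner_smul_right (c : ℂ) (ξ η : truncSpace n) :
    inner ℂ ξ (c • η) = c * inner ℂ ξ η := inner_smul_right ξ η c

theorem truncInner_smul_left (c : ℂ) (ξ η : truncSpace n) :
    inner ℂ (c • ξ) η = star c * inner ℂ ξ η := inner_smul_left ξ η c

theorem truncInner_self (ξ : truncSpace n) : inner ℂ ξ ξ = ((‖ξ‖ ^ 2 : ℝ) : ℂ) := by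
  push_cast
  exact inner_self_eq_norm_sq_to_K (𝕜 := ℂ) ξ

theorem repr_eq_zero_of_mem {ξ : L2S1} (hξ : ξ ∈ truncSpace n) {k : ℤ}
    (hk : ∀ j : Fin n, k ≠ j + 1) : fourierBasis.repr ξ k = 0 := by
  induction hξ using Submodule.span_induction with
  | mem x hx =>
    obtain ⟨j, rfl⟩ := hx
    rw [repr_fourierLp, if_neg (hk j)]
  | zero => simp
  | add x y _ _ hx hy => rw [map_add, lp.coeFn_add, Pi.add_apply, hx, hy, add_zero]
  | smul c x _ hx => rw [map_smul, lp.coeFn_smul, Pi.smul_apply, hx, smul_zero]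

theorem inner_truncDirac (j : Fin n) (ξ : (truncDirac n).domain) :
    inner ℂ (truncBasis n j) (truncDirac n ξ) =
      ((j : ℂ) + 1) * inner ℂ (truncBasis n j) (ξ : truncSpace n) := by
  change inner ℂ (truncBasis n j) ((truncSpace n).orthogonalProjectionOnto (circleDirac _)) = _
  rw [inner_truncBasis_proj, repr_circleDirac, inner_truncBasis]
  push_cast
  rfl

theorem mem_truncDirac_domain (ξ : truncSpace n) : ξ ∈ (truncDirac n).domain := by
  rw [truncDirac_domain]; trivial

/-- `D` is diagonal in the `e_k`, so it preserves their span and its truncation is a restriction. -/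
theorem coe_truncDirac (ξ : truncSpace n) :
    (truncDirac n ⟨ξ, mem_truncDirac_domain ξ⟩ : L2S1) =
      circleDirac ⟨ξ, truncSpace_le_domain n ξ.2⟩ := by
  refine L2S1_ext fun k => ?_
  rw [repr_circleDirac]
  by_cases hk : ∃ j : Fin n, k = j + 1
  · obtain ⟨j, rfl⟩ := hk
    rw [← inner_truncBasis, inner_truncDirac, inner_truncBasis]
    push_cast
    rfl
  · push Not at hk
    rw [repr_eq_zero_of_mem (Subtype.mem _) hk, repr_eq_zero_of_mem ξ.2 hk, mul_zero]

theorem truncDirac_proj {η : L2S1} (h : η ∈ circleDirac.domain) :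
    truncDirac n ⟨(truncSpace n).orthogonalProjectionOnto η, mem_truncDirac_domain _⟩ =
      (truncSpace n).orthogonalProjectionOnto (circleDirac ⟨η, h⟩) := by
  refine truncSpace_ext fun j => ?_
  rw [inner_truncDirac, inner_truncBasis_proj, inner_truncBasis_proj, repr_circleDirac]
  push_cast
  rfl

/-- Compression does not increase commutators with the Dirac operator. -/
theorem CommutatorBound.compress {T : L2S1 →L[ℂ] L2S1} {C : ℝ≥0}
    (h : CommutatorBound circleDirac T C) :
    CommutatorBound (truncDirac n) (compressL (truncSpace n) T) C := by
  intro ξ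
  refine ⟨mem_truncDirac_domain _, ?_⟩
  obtain ⟨hd, hle⟩ := h ⟨(ξ : truncSpace n), truncSpace_le_domain n (ξ : truncSpace n).2⟩
  have h1 : compressL (truncSpace n) T (truncDirac n ξ) =
      (truncSpace n).orthogonalProjectionOnto
        (T (circleDirac ⟨(ξ : truncSpace n), truncSpace_le_domain n (ξ : truncSpace n).2⟩)) := by
    rw [← coe_truncDirac]
    rfl
  have h2 : truncDirac n ⟨compressL (truncSpace n) T (ξ : truncSpace n), mem_truncDirac_domain _⟩ =
      (truncSpace n).orthogonalProjectionOnto (circleDirac ⟨_, hd⟩) := truncDirac_proj hd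
  -- As the projection commutes with `D`, the commutator of the compression is the compression of
  -- the commutator.
  rw [h1, h2, ← map_sub]
  exact (Submodule.norm_orthogonalProjectionOnto_apply_le _ _).trans hle

theorem isPositive_compressL {T : L2S1 →L[ℂ] L2S1} (hT : T.IsPositive) :
    (compressL (truncSpace n) T).IsPositive := by
  have := hT.orthogonalProjectionOnto_comp (truncSpace n)
  exact this

theorem inner_compressL_mulRep (f : C(S1, ℂ)) (j l : Fin n) :
    inner ℂ (truncBasis n j) (compressL (truncSpace n) (mulRep f) (truncBasis n l)) =
      fourierCoeff f ((j : ℤ) - l) := by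
  refine (inner_truncBasis_proj j _).trans ?_
  refine (congrArg (fun v => fourierBasis.repr (mulRep f v) ((j : ℤ) + 1))
    (coe_truncBasis l)).trans ?_
  rw [repr_mulRep_fourierLp, add_sub_add_right_eq_sub]

/-! ### The symbol of an operator on the truncated space -/

/-- The symbol of an operator: the average of its matrix entries along diagonals. -/
def symbolMap (n : ℕ) : (truncSpace n →L[ℂ] truncSpace n) →ₗ[ℂ] C(S1, ℂ) where
  toFun B := (1 / n : ℂ) • ∑ j : Fin n, ∑ l : Fin n,
    inner ℂ (truncBasis n j) (B (truncBasis n l)) • fourier ((j : ℤ) - l)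
  map_add' B B' := by
    simp only [add_apply, inner_add_right, add_smul, Finset.sum_add_distrib, smul_add]
  map_smul' c B := by
    simp only [smul_apply, truncInner_smul_right, mul_smul, ← Finset.smul_sum, RingHom.id_apply]
    rw [smul_comm]

/-- The vector `∑ exp (-i l x) e_l` of the truncated space. -/
def symbolVector (n : ℕ) (x : S1) : truncSpace n :=
  ∑ l : Fin n, (fourier (-(l : ℤ)) x : ℂ) • truncBasis n l

/-- Since `symbolVector n x` has squared length `n`, this is a vector state of `B` when `n > 0`;
positivity, unitality and contractivity of the symbol all come from here. -/
theorem symbolMap_apply (B : truncSpace n →L[ℂ] truncSpace n) (x : S1) :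
    symbolMap n B x = (1 / n : ℂ) * inner ℂ (symbolVector n x) (B (symbolVector n x)) := by
  simp only [symbolMap, LinearMap.coe_mk, AddHom.coe_mk, ContinuousMap.smul_apply, smul_eq_mul,
    ContinuousMap.sum_apply, symbolVector, sum_inner, map_sum, map_smul, inner_sum,
    truncInner_smul_left, truncInner_smul_right]
  congr 1
  rw [Finset.sum_comm]
  refine Finset.sum_congr rfl fun l _ => Finset.sum_congr rfl fun j _ => ?_
  rw [sub_eq_add_neg, fourier_add, fourier_neg (n := (j : ℤ)), Complex.star_def, Complex.conj_conj]
  ring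

theorem norm_sq_symbolVector (x : S1) : ‖symbolVector n x‖ ^ 2 = n := by
  have h := (truncBasis n).sum_sq_norm_inner_right (symbolVector n x)
  rw [← h]
  have h1 : ∀ j, ‖inner ℂ (truncBasis n j) (symbolVector n x)‖ = 1 := fun j => by
    rw [symbolVector, (truncBasis n).orthonormal.inner_right_fintype, fourier_apply]
    exact Circle.norm_coe _
  simp only [h1, one_pow, Finset.sum_const, Finset.card_univ, Fintype.card_fin, nsmul_eq_mul,
    mul_one]

theorem norm_symbolMap_le (B : truncSpace n →L[ℂ] truncSpace n) : ‖symbolMap n B‖ ≤ ‖B‖ := by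
  refine (ContinuousMap.norm_le _ (norm_nonneg B)).2 fun x => ?_
  rw [symbolMap_apply, norm_mul]
  have h1 : ‖inner ℂ (symbolVector n x) (B (symbolVector n x))‖ ≤ n * ‖B‖ := by
    refine (norm_inner_le_norm (𝕜 := ℂ) (symbolVector n x) _).trans ?_
    rw [← norm_sq_symbolVector x]
    have := B.le_opNorm (symbolVector n x)
    nlinarith [norm_nonneg (symbolVector n x), norm_nonneg B]
  rcases Nat.eq_zero_or_pos n with rfl | hn
  · simp
  · have hn' : (0 : ℝ) < n := by exact_mod_cast hn
    have h2 : ‖(1 / n : ℂ)‖ = 1 / n := by simp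
    rw [h2, div_mul_eq_mul_div, one_mul, div_le_iff₀ hn', mul_comm ‖B‖]
    exact h1

theorem symbolMap_nonneg {B : truncSpace n →L[ℂ] truncSpace n} (hB : B.IsPositive) (x : S1) :
    0 ≤ symbolMap n B x := by
  rw [symbolMap_apply]
  refine mul_nonneg ?_ (hB.inner_nonneg_right _)
  rw [one_div, ← Complex.ofReal_natCast, ← Complex.ofReal_inv, Complex.zero_le_real]
  positivity

theorem symbolMap_one (hn : 0 < n) : symbolMap n 1 = 1 := by
  ext x
  have hn' : (n : ℂ) ≠ 0 := by exact_mod_cast hn.ne'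
  rw [symbolMap_apply, one_apply_eq_self, truncInner_self, norm_sq_symbolVector,
    Complex.ofReal_natCast, one_div, inv_mul_cancel₀ hn']
  rfl

theorem symbolMap_mem_smooth (B : truncSpace n →L[ℂ] truncSpace n) :
    symbolMap n B ∈ smoothFunctions :=
  smoothFunctions.smul_mem _ <| smoothFunctions.sum_mem fun _ _ =>
    smoothFunctions.sum_mem fun _ _ => smoothFunctions.smul_mem _ (smooth_fourier _)

/-- The compression has entries `f_{j-l}`, and `f_k` occurs `n - |k|` times; after division by `n`
this is the Fejér weight. -/
theorem symbolMap_compressL (hn : 0 < n) (f : C(S1, ℂ)) :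
    symbolMap n (compressL (truncSpace n) (mulRep f)) = fejerMean n f := by
  simp only [symbolMap, LinearMap.coe_mk, AddHom.coe_mk, inner_compressL_mulRep]
  rw [sum_sum_sub_eq n fun k => fourierCoeff f k • (fourier k : C(S1, ℂ)), Finset.smul_sum,
    fejerMean]
  refine Finset.sum_congr rfl fun k hk => ?_
  rw [smul_smul, coeff_fejer hn hk]

/-- The commutator of the truncated Dirac operator with an operator. -/
def truncCommutator (B : truncSpace n →L[ℂ] truncSpace n) : truncSpace n →L[ℂ] truncSpace n :=
  LinearMap.toContinuousLinearMap
    { toFun := fun ξ => truncDirac n ⟨B ξ, mem_truncDirac_domain _⟩ -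
        B (truncDirac n ⟨ξ, mem_truncDirac_domain _⟩)
      map_add' := fun ξ η => by
        refine truncSpace_ext fun j => ?_
        have h : truncDirac n ⟨ξ + η, mem_truncDirac_domain _⟩ =
            truncDirac n ⟨ξ, mem_truncDirac_domain _⟩ + truncDirac n ⟨η, mem_truncDirac_domain _⟩ :=
          (truncDirac n).map_add ⟨ξ, mem_truncDirac_domain _⟩ ⟨η, mem_truncDirac_domain _⟩
        simp only [h, inner_sub_right, inner_add_right, inner_truncDirac, map_add]
        ring
      map_smul' := fun c ξ => by
        refine truncSpace_ext fun j => ?_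
        have h : truncDirac n ⟨c • ξ, mem_truncDirac_domain _⟩ =
            c • truncDirac n ⟨ξ, mem_truncDirac_domain _⟩ :=
          (truncDirac n).map_smul c ⟨ξ, mem_truncDirac_domain _⟩
        simp only [h, inner_sub_right, truncInner_smul_right, inner_truncDirac, map_smul,
          RingHom.id_apply]
        ring }

theorem truncCommutator_apply (B : truncSpace n →L[ℂ] truncSpace n) (ξ : truncSpace n) :
    truncCommutator B ξ = truncDirac n ⟨B ξ, mem_truncDirac_domain _⟩ -
        B (truncDirac n ⟨ξ, mem_truncDirac_domain _⟩) := rfl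

theorem norm_truncCommutator_le {B : truncSpace n →L[ℂ] truncSpace n}
    (h : CommutatorBound (truncDirac n) B 1) : ‖truncCommutator B‖ ≤ 1 :=
  ContinuousLinearMap.opNorm_le_bound _ zero_le_one fun ξ =>
    (h ⟨ξ, mem_truncDirac_domain _⟩).choose_spec

theorem truncDirac_truncBasis (l : Fin n) :
    truncDirac n ⟨truncBasis n l, mem_truncDirac_domain _⟩ = ((l : ℂ) + 1) • truncBasis n l := by
  refine truncSpace_ext fun j => ?_
  rw [inner_truncDirac, truncInner_smul_right, orthonormal_iff_ite.1 (truncBasis n).orthonormal]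
  split_ifs with h <;> simp [h]

theorem inner_truncCommutator (B : truncSpace n →L[ℂ] truncSpace n) (j l : Fin n) :
    inner ℂ (truncBasis n j) (truncCommutator B (truncBasis n l)) =
      (((j : ℤ) - l : ℤ) : ℂ) * inner ℂ (truncBasis n j) (B (truncBasis n l)) := by
  rw [truncCommutator_apply, inner_sub_right, inner_truncDirac, truncDirac_truncBasis, map_smul,
    truncInner_smul_right]
  push_cast
  ring

/-- Both commutators multiply by `j - l`: one the matrix entry at `(j, l)`, the other the
exponential `e_{j-l}` attached to it. -/
theorem hasDiracCommutator_symbolMap (B : truncSpace n →L[ℂ] truncSpace n) :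
    HasDiracCommutator (symbolMap n B) (symbolMap n (truncCommutator B)) := by
  refine HasDiracCommutator.smul (HasDiracCommutator.sum _ fun j _ =>
    HasDiracCommutator.sum _ fun l _ => ?_) _
  have h := (hasDiracCommutator_fourier ((j : ℤ) - l)).smul
    (inner ℂ (truncBasis n j) (B (truncBasis n l)))
  rwa [smul_smul, mul_comm _ (((j : ℤ) - l : ℤ) : ℂ), ← inner_truncCommutator] at h

theorem CommutatorBound.symbol {B : truncSpace n →L[ℂ] truncSpace n}
    (h : CommutatorBound (truncDirac n) B 1) :
    CommutatorBound circleDirac (mulRep (symbolMap n B)) 1 :=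
  (hasDiracCommutator_symbolMap B).commutatorBound
    ((norm_symbolMap_le _).trans (norm_truncCommutator_le h))

/-! ### Representatives of bounded energy -/

/-- The left side is the squared length of the `l`-th column of the commutator. -/
theorem sum_sq_truncCommutator_le {B : truncSpace n →L[ℂ] truncSpace n}
    (h : CommutatorBound (truncDirac n) B 1) (l : Fin n) :
    ∑ j : Fin n, ‖(((j : ℤ) - l : ℤ) : ℂ) * inner ℂ (truncBasis n j) (B (truncBasis n l))‖ ^ 2
      ≤ 1 := by
  simp only [← inner_truncCommutator]
  rw [(truncBasis n).sum_sq_norm_inner_right]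
  have h1 := (truncCommutator B).le_opNorm (truncBasis n l)
  rw [(truncBasis n).norm_eq_one, mul_one] at h1
  exact pow_le_one₀ (norm_nonneg _) (h1.trans (norm_truncCommutator_le h))

/-- The partial sum of the Fourier series of a function on the circle. -/
def fourierPartialSum (n : ℕ) (f : C(S1, ℂ)) : C(S1, ℂ) :=
  ∑ k ∈ Finset.Ioo (-(n : ℤ)) n, fourierCoeff f k • fourier k

theorem fourierCoeff_partialSum (f : C(S1, ℂ)) (k : ℤ) :
    fourierCoeff (fourierPartialSum n f) k =
      if k ∈ Finset.Ioo (-(n : ℤ)) n then fourierCoeff f k else 0 := by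
  have h : ∀ g : C(S1, ℂ), fourierCoeff g k =
      fourierBasis.repr (ContinuousMap.toLp (E := ℂ) 2 AddCircle.haarAddCircle ℂ g) k := fun g => by
    rw [fourierBasis_repr, fourierCoeff_toLp]
  rw [h, fourierPartialSum, map_sum, map_sum, lp.coeFn_sum, Finset.sum_apply]
  simp only [map_smul, lp.coeFn_smul, Pi.smul_apply, ← h, fourierCoeff_fourier, smul_eq_mul,
    Pi.single_apply, mul_ite, mul_one, mul_zero, Finset.sum_ite_eq]

/-- The matrix of the compression involves only the coefficients `f_{j-l}`, and `|j - l| < n`. -/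
theorem compressL_fourierPartialSum (f : C(S1, ℂ)) :
    compressL (truncSpace n) (mulRep (fourierPartialSum n f)) =
      compressL (truncSpace n) (mulRep f) := by
  refine ContinuousLinearMap.coe_injective ((truncBasis n).toBasis.ext fun l => ?_)
  refine truncSpace_ext fun j => ?_
  simp only [OrthonormalBasis.coe_toBasis, ContinuousLinearMap.coe_coe, inner_compressL_mulRep,
    fourierCoeff_partialSum]
  rw [if_pos]
  rw [Finset.mem_Ioo]
  omega

/-- The first column of a Toeplitz matrix shows the coefficients with `0 ≤ k < n`, the last one
those with `-n < k ≤ 0`. Each column of the commutator has length at most 1, so the energy is at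
most `1 + 1`. -/
theorem energyLE_fourierPartialSum (hn : 0 < n) {f : C(S1, ℂ)}
    (h : CommutatorBound (truncDirac n) (compressL (truncSpace n) (mulRep f)) 1) :
    EnergyLE (fourierPartialSum n f) (√2) := by
  refine ⟨Real.sqrt_nonneg _, fun s => ?_⟩
  rw [Real.sq_sqrt zero_le_two]
  set u : ℤ → ℝ := fun k => ((k : ℝ) * ‖fourierCoeff f k‖) ^ 2 with hu
  have hu0 : ∀ k, 0 ≤ u k := fun k => sq_nonneg _
  have hcol : ∀ l : Fin n, ∑ j : Fin n, u ((j : ℤ) - l) ≤ 1 := fun l => by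
    refine le_trans (le_of_eq (Finset.sum_congr rfl fun j _ => ?_)) (sum_sq_truncCommutator_le h l)
    rw [inner_compressL_mulRep, norm_mul, Complex.norm_intCast, hu]
    simp only [mul_pow, sq_abs]
  have h1 : ∑ k ∈ s, ((k : ℝ) * ‖fourierCoeff (fourierPartialSum n f) k‖) ^ 2 ≤
      ∑ k ∈ Finset.Ioo (-(n : ℤ)) n, u k := by
    simp only [fourierCoeff_partialSum]
    calc _ = ∑ k ∈ s, if k ∈ Finset.Ioo (-(n : ℤ)) n then u k else 0 := by
          refine Finset.sum_congr rfl fun k _ => ?_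
          split_ifs <;> simp [hu]
      _ = ∑ k ∈ s ∩ Finset.Ioo (-(n : ℤ)) n, u k := by rw [Finset.sum_ite_mem]
      _ ≤ _ := Finset.sum_le_sum_of_subset_of_nonneg Finset.inter_subset_right fun k _ _ => hu0 k
  have h2 : ∀ l : Fin n, ∑ j : Fin n, u ((j : ℤ) - l) =
      ∑ k ∈ Finset.univ.image fun j : Fin n => (j : ℤ) - l, u k := fun l => by
    rw [Finset.sum_image fun a _ b _ hab => ?_]
    have : (a : ℤ) = b := by simpa using hab
    exact Fin.ext (by exact_mod_cast this)
  have h3 : Finset.Ioo (-(n : ℤ)) n ⊆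
      (Finset.univ.image fun j : Fin n => (j : ℤ) - (⟨0, hn⟩ : Fin n)) ∪
      Finset.univ.image fun j : Fin n => (j : ℤ) - (⟨n - 1, by omega⟩ : Fin n) := by
    intro k hk
    rw [Finset.mem_Ioo] at hk
    rw [Finset.mem_union, Finset.mem_image, Finset.mem_image]
    rcases le_total 0 k with hk0 | hk0
    · exact Or.inl ⟨⟨k.toNat, by omega⟩, Finset.mem_univ _, by simp; omega⟩
    · exact Or.inr ⟨⟨(k + n - 1).toNat, by omega⟩, Finset.mem_univ _, by simp; omega⟩
  refine h1.trans ((Finset.sum_le_sum_of_subset_of_nonneg h3 fun k _ _ => hu0 k).trans ?_)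
  have h4 := Finset.sum_union_inter (f := u)
    (s₁ := Finset.univ.image fun j : Fin n => (j : ℤ) - (⟨0, hn⟩ : Fin n))
    (s₂ := Finset.univ.image fun j : Fin n => (j : ℤ) - (⟨n - 1, by omega⟩ : Fin n))
  have h5 := hcol ⟨0, hn⟩
  have h6 := hcol ⟨n - 1, by omega⟩
  rw [h2] at h5 h6
  have h7 := Finset.sum_nonneg fun k (_ : k ∈
    (Finset.univ.image fun j : Fin n => (j : ℤ) - (⟨0, hn⟩ : Fin n)) ∩
    Finset.univ.image fun j : Fin n => (j : ℤ) - (⟨n - 1, by omega⟩ : Fin n)) => hu0 k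
  linarith

end Truncation

/-! ### Maps between the state spaces and the Gromov–Hausdorff estimate -/

section StateSpaces

variable {n : ℕ}

/-- Compression, as a map from the circle to the Toeplitz operator system. -/
def compressElem (n : ℕ) : circleSystem.carrier →ₗ[ℂ] (toeplitzSystem n).carrier :=
  (compressL (truncSpace n)).restrict fun _ hT => Submodule.mem_map_of_mem hT

/-- The symbol, as a map from the Toeplitz operator system to the circle. -/
def symbolElem (n : ℕ) : (toeplitzSystem n).carrier →ₗ[ℂ] circleSystem.carrier :=
  circleElem ∘ₗ symbolMap n ∘ₗ (toeplitzSystem n).carrier.subtype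

theorem exists_compressElem_eq (T : (toeplitzSystem n).carrier) :
    ∃ f : C(S1, ℂ), compressElem n (circleElem f) = T := by
  obtain ⟨_, _, ⟨f, rfl⟩, h⟩ := T
  exact ⟨f, Subtype.ext h⟩

theorem compressElem_unit : compressElem n circleSystem.unit = (toeplitzSystem n).unit := by
  refine Subtype.ext (ContinuousLinearMap.ext fun ξ => ?_)
  exact Submodule.orthogonalProjectionOnto_mem_subspace_eq_self ξ

theorem symbolElem_unit (hn : 0 < n) : symbolElem n (toeplitzSystem n).unit = circleSystem.unit := by
  rw [← circleElem_one, ← symbolMap_one hn]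
  rfl

theorem symbolElem_compressElem (hn : 0 < n) (f : C(S1, ℂ)) :
    symbolElem n (compressElem n (circleElem f)) = circleElem (fejerMean n f) := by
  rw [← symbolMap_compressL hn]
  rfl

/-- The state on the circle obtained from a state on the Toeplitz system by compression. -/
def compressState (φ : (toeplitzSystem n).State) : circleSystem.State :=
  .ofPositive (φ.toFunctional.toLinearMap ∘ₗ compressElem n)
    (fun _ hT => φ.nonneg _ (isPositive_compressL hT))
    ((congrArg φ.toFunctional compressElem_unit).trans φ.apply_unit)

/-- The state on the Toeplitz system obtained from a state on the circle by taking symbols. -/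
def symbolState (hn : 0 < n) (ψ : circleSystem.State) : (toeplitzSystem n).State :=
  .ofPositive (ψ.toFunctional.toLinearMap ∘ₗ symbolElem n)
    (fun _ hT => ψ.nonneg _ (isPositive_mulRep (symbolMap_nonneg hT)))
    ((congrArg ψ.toFunctional (symbolElem_unit hn)).trans ψ.apply_unit)

theorem compressState_apply (φ : (toeplitzSystem n).State) (T : circleSystem.carrier) :
    (compressState φ).toFunctional T = φ.toFunctional (compressElem n T) := rfl

theorem symbolState_apply (hn : 0 < n) (ψ : circleSystem.State) (T : (toeplitzSystem n).carrier) :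
    (symbolState hn ψ).toFunctional T = ψ.toFunctional (symbolElem n T) := rfl

/-- An upper bound for Connes' distance on the circle. -/
theorem circleDist_le {φ ψ : circleSystem.State} {r : ℝ≥0∞}
    (h : ∀ f : C(S1, ℂ), f ∈ smoothFunctions → CommutatorBound circleDirac (mulRep f) 1 →
      ‖φ.toFunctional (circleElem f) - ψ.toFunctional (circleElem f)‖ₑ ≤ r) :
    circleDist φ ψ ≤ r := by
  refine iSup_le fun T => iSup_le fun hA => iSup_le fun hT => ?_
  obtain ⟨f, hf, hfT⟩ := hA
  obtain rfl : circleElem f = T := Subtype.ext hfT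
  exact h f hf (lipSeminorm_le_one_iff.1 hT)

/-- An upper bound for Connes' distance on the Toeplitz system. -/
theorem toeplitzDist_le {φ ψ : (toeplitzSystem n).State} {r : ℝ≥0∞}
    (h : ∀ T : (toeplitzSystem n).carrier,
      CommutatorBound (truncDirac n) (T : truncSpace n →L[ℂ] truncSpace n) 1 →
      ‖φ.toFunctional T - ψ.toFunctional T‖ₑ ≤ r) :
    toeplitzDist n φ ψ ≤ r :=
  iSup_le fun T => iSup_le fun _ => iSup_le fun hT => h T (lipSeminorm_le_one_iff.1 hT)

/-- Compression maps the Lipschitz ball into the Lipschitz ball, so the supremum on the left runs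
over fewer test elements. -/
theorem circleDist_compressState_le (φ ψ : (toeplitzSystem n).State) :
    circleDist (compressState φ) (compressState ψ) ≤ toeplitzDist n φ ψ :=
  circleDist_le fun f _ hf =>
    OperatorSystem.enorm_sub_le_connesDist _ _ (T := compressElem n (circleElem f))
      (compressElem n (circleElem f)).2 (lipSeminorm_le_one_iff.2 hf.compress) φ ψ

theorem toeplitzDist_symbolState_le (hn : 0 < n) (φ ψ : circleSystem.State) :
    toeplitzDist n (symbolState hn φ) (symbolState hn ψ) ≤ circleDist φ ψ :=
  toeplitzDist_le fun T hT =>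
    OperatorSystem.enorm_sub_le_connesDist circleSmooth circleDirac (T := symbolElem n T)
      ⟨_, symbolMap_mem_smooth _, rfl⟩ (lipSeminorm_le_one_iff.2 hT.symbol) φ ψ

theorem CommutatorBound.energyLE {f : C(S1, ℂ)} (h : CommutatorBound circleDirac (mulRep f) 1) :
    EnergyLE f 1 :=
  ⟨zero_le_one, fun s => by simpa using h.sum_sq_fourierCoeff_le s⟩

/-- The lift need not lie in the Lipschitz ball of the circle; bounded energy is all that the Fejér
estimate needs. -/
theorem exists_energyLE (hn : 0 < n) {T : (toeplitzSystem n).carrier}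
    (h : CommutatorBound (truncDirac n) (T : truncSpace n →L[ℂ] truncSpace n) 1) :
    ∃ f : C(S1, ℂ), compressElem n (circleElem f) = T ∧ EnergyLE f (√2) := by
  obtain ⟨f, rfl⟩ := exists_compressElem_eq T
  exact ⟨fourierPartialSum n f, Subtype.ext (compressL_fourierPartialSum f),
    energyLE_fourierPartialSum hn h⟩

theorem EnergyLE.norm_sub_fejerMean_apply_le {f : C(S1, ℂ)} {M : ℝ} (h : EnergyLE f M)
    (hn : 0 < n) (ψ : circleSystem.State) :
    ‖ψ.toFunctional (circleElem f) - ψ.toFunctional (circleElem (fejerMean n f))‖ ≤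
      M * fejerRate n := by
  rw [← map_sub, ← map_sub]
  exact (ψ.norm_apply_le _).trans ((norm_circleElem_le _).trans (h.norm_sub_fejerMean_le hn))

theorem circleDist_compressState_symbolState_le (hn : 0 < n) (ψ : circleSystem.State) :
    circleDist ψ (compressState (symbolState hn ψ)) ≤ ENNReal.ofReal (fejerRate n) :=
  circleDist_le fun f _ hf => by
    rw [compressState_apply, symbolState_apply, symbolElem_compressElem hn, ← ofReal_norm]
    refine ENNReal.ofReal_le_ofReal ?_
    simpa using hf.energyLE.norm_sub_fejerMean_apply_le hn ψ

/-- With `T = R f`, the two states take at `T` the values of `compressState φ` at `f` and at its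
Fejér mean, so no separate estimate on matrices is required. -/
theorem toeplitzDist_symbolState_compressState_le (hn : 0 < n) (φ : (toeplitzSystem n).State) :
    toeplitzDist n φ (symbolState hn (compressState φ)) ≤ ENNReal.ofReal (√2 * fejerRate n) :=
  toeplitzDist_le fun T hT => by
    obtain ⟨f, rfl, hf⟩ := exists_energyLE hn hT
    rw [symbolState_apply, symbolElem_compressElem hn, ← ofReal_norm]
    exact ENNReal.ofReal_le_ofReal (hf.norm_sub_fejerMean_apply_le hn (compressState φ))

theorem compressState_injective :
    Function.Injective (compressState : (toeplitzSystem n).State → circleSystem.State) := by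
  intro φ ψ h
  ext T
  obtain ⟨f, rfl⟩ := exists_compressElem_eq T
  exact congrArg (fun χ : circleSystem.State => χ.toFunctional (circleElem f)) h

/-- Inherited from the circle along `compressState`, which is injective and does not increase
distances. -/
theorem toeplitzDist_separates {φ ψ : (toeplitzSystem n).State} (h : toeplitzDist n φ ψ = 0) :
    φ = ψ :=
  compressState_injective <| circleDist_separates <|
    nonpos_iff_eq_zero.1 <| (circleDist_compressState_le φ ψ).trans h.le

theorem exists_fejerRate_lt (M : ℝ) {ε : ℝ} (hε : 0 < ε) :
    ∃ n : ℕ, 0 < n ∧ 2 * (M * fejerRate n) < ε := by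
  have h := (tendsto_fejerRate.const_mul M).const_mul 2
  rw [mul_zero, mul_zero] at h
  obtain ⟨n, hn, hn0⟩ := ((h.eventually (gt_mem_nhds hε)).and (eventually_gt_atTop 0)).exists
  exact ⟨n, hn0, hn⟩

theorem exists_finset_circleDist_le {ε : ℝ} (hε : 0 < ε) :
    ∃ (F : Finset ℤ) (a : ℤ → circleSystem.carrier), ∀ φ ψ : circleSystem.State,
      circleDist φ ψ ≤
        ENNReal.ofReal (∑ k ∈ F, ‖φ.toFunctional (a k) - ψ.toFunctional (a k)‖ + ε) := by
  obtain ⟨N, hN, hNε⟩ := exists_fejerRate_lt 1 hε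
  refine ⟨Finset.Ioo (-(N : ℤ)) N, fun k => circleElem (((1 : ℝ) : ℂ) • fourier k), fun φ ψ =>
    circleDist_le fun f _ hf => ?_⟩
  rw [← ofReal_norm]
  exact ENNReal.ofReal_le_ofReal
    ((hf.energyLE.norm_state_sub_le hN φ ψ).trans (add_le_add_right hNε.le _))

theorem exists_finset_toeplitzDist_le (hn : 0 < n) {ε : ℝ} (hε : 0 < ε) :
    ∃ (F : Finset ℤ) (a : ℤ → (toeplitzSystem n).carrier), ∀ φ ψ : (toeplitzSystem n).State,
      toeplitzDist n φ ψ ≤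
        ENNReal.ofReal (∑ k ∈ F, ‖φ.toFunctional (a k) - ψ.toFunctional (a k)‖ + ε) := by
  obtain ⟨N, hN, hNε⟩ := exists_fejerRate_lt (√2) hε
  refine ⟨Finset.Ioo (-(N : ℤ)) N,
    fun k => compressElem n (circleElem (((√2 : ℝ) : ℂ) • fourier k)), fun φ ψ =>
    toeplitzDist_le fun T hT => ?_⟩
  obtain ⟨f, rfl, hf⟩ := exists_energyLE hn hT
  rw [← ofReal_norm]
  exact ENNReal.ofReal_le_ofReal
    ((hf.norm_state_sub_le hN (compressState φ) (compressState ψ)).trans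
      (add_le_add_right hNε.le _))

theorem exists_metricSpace_circle :
    ∃ m : MetricSpace circleSystem.State,
      (∀ φ ψ : circleSystem.State, m.toPseudoMetricSpace.edist φ ψ = circleDist φ ψ) ∧
      m.toUniformSpace.toTopologicalSpace = circleSystem.weakStarTopology :=
  OperatorSystem.exists_metricSpace _ _ (fun _ _ => circleDist_separates)
    fun _ hε => exists_finset_circleDist_le hε

theorem exists_metricSpace_toeplitz (hn : 0 < n) :
    ∃ m : MetricSpace (toeplitzSystem n).State,
      (∀ φ ψ : (toeplitzSystem n).State,
        m.toPseudoMetricSpace.edist φ ψ = toeplitzDist n φ ψ) ∧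
      m.toUniformSpace.toTopologicalSpace = (toeplitzSystem n).weakStarTopology :=
  OperatorSystem.exists_metricSpace _ _ (fun _ _ => toeplitzDist_separates)
    fun _ hε => exists_finset_toeplitzDist_le hn hε

theorem nonempty_circleState : Nonempty circleSystem.State :=
  ⟨.ofVector _ (fourierLp 2 0) (orthonormal_fourier.norm_eq_one 0)⟩

/-- `compressState` is almost an isometry: it does not increase distances, and returning by the
1-Lipschitz map `symbolState` moves each of the two points by at most `√2 γ_n`. Its range is
`γ_n`-dense. -/
theorem ghDist_le (hn : 0 < n) [MetricSpace (toeplitzSystem n).State]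
    [MetricSpace circleSystem.State] [Nonempty (toeplitzSystem n).State]
    [CompactSpace (toeplitzSystem n).State] [Nonempty circleSystem.State]
    [CompactSpace circleSystem.State]
    (hX : ∀ φ ψ : (toeplitzSystem n).State, edist φ ψ = toeplitzDist n φ ψ)
    (hY : ∀ φ ψ : circleSystem.State, edist φ ψ = circleDist φ ψ) :
    GromovHausdorff.ghDist (toeplitzSystem n).State circleSystem.State ≤
      (√2 + 1) * fejerRate n := by
  have h1 : ∀ φ ψ : (toeplitzSystem n).State,
      dist (compressState φ) (compressState ψ) ≤ dist φ ψ := fun φ ψ => by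
    rw [dist_edist, dist_edist, hX, hY]
    exact ENNReal.toReal_mono (hX φ ψ ▸ edist_ne_top φ ψ) (circleDist_compressState_le φ ψ)
  have h2 : ∀ φ ψ : circleSystem.State,
      dist (symbolState hn φ) (symbolState hn ψ) ≤ dist φ ψ := fun φ ψ => by
    rw [dist_edist, dist_edist, hX, hY]
    exact ENNReal.toReal_mono (hY φ ψ ▸ edist_ne_top φ ψ) (toeplitzDist_symbolState_le hn φ ψ)
  have h3 : ∀ ψ : circleSystem.State,
      dist ψ (compressState (symbolState hn ψ)) ≤ fejerRate n := fun ψ => by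
    rw [dist_edist, hY]
    exact ENNReal.toReal_le_of_le_ofReal (fejerRate_nonneg n)
      (circleDist_compressState_symbolState_le hn ψ)
  have h4 : ∀ φ : (toeplitzSystem n).State,
      dist φ (symbolState hn (compressState φ)) ≤ √2 * fejerRate n := fun φ => by
    rw [dist_edist, hX]
    exact ENNReal.toReal_le_of_le_ofReal (mul_nonneg (Real.sqrt_nonneg _) (fejerRate_nonneg n))
      (toeplitzDist_symbolState_compressState_le hn φ)
  -- The resulting bound is `ε₁ + ε₂ / 2 + ε₃`; the distortion `ε₂` counts `√2 γ_n` once for each of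
  -- the two points.
  refine (GromovHausdorff.ghDist_le_of_approx_subsets (s := Set.univ)
    (fun φ => compressState φ.1) (ε₁ := 0) (ε₂ := 2 * (√2 * fejerRate n)) (ε₃ := fejerRate n)
    (fun φ => ⟨φ, Set.mem_univ _, (dist_self φ).le⟩)
    (fun ψ => ⟨⟨symbolState hn ψ, Set.mem_univ _⟩, h3 ψ⟩) fun φ ψ => ?_).trans ?_
  · rw [abs_le]
    change _ ≤ dist φ.1 ψ.1 - _ ∧ dist φ.1 ψ.1 - _ ≤ _
    have h5 := h1 φ.1 ψ.1
    have h6 := h2 (compressState φ.1) (compressState ψ.1)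
    have h7 := dist_triangle4_right φ.1 ψ.1 (symbolState hn (compressState φ.1))
      (symbolState hn (compressState ψ.1))
    have h8 := h4 φ.1
    have h9 := h4 ψ.1
    have h10 := mul_nonneg (Real.sqrt_nonneg 2) (fejerRate_nonneg n)
    constructor <;> linarith
  · linarith

end StateSpaces

end

theorem mainTheorem3 :
    ∃ (m : ∀ n : ℕ, MetricSpace (toeplitzSystem (n + 1)).State)
      (m' : MetricSpace circleSystem.State)
      (_ : ∀ n : ℕ, Nonempty (toeplitzSystem (n + 1)).State)
      (_ : ∀ n : ℕ, CompactSpace (toeplitzSystem (n + 1)).State)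
      (_ : Nonempty circleSystem.State)
      (_ : CompactSpace circleSystem.State),
      (∀ (n : ℕ) (φ ψ : (toeplitzSystem (n + 1)).State),
        edist φ ψ = toeplitzDist (n + 1) φ ψ) ∧
      (∀ φ ψ : circleSystem.State, edist φ ψ = circleDist φ ψ) ∧
      (∀ n : ℕ, (m n).toUniformSpace.toTopologicalSpace =
        (toeplitzSystem (n + 1)).weakStarTopology) ∧
      m'.toUniformSpace.toTopologicalSpace = circleSystem.weakStarTopology ∧
      Tendsto
        (fun n : ℕ =>
          GromovHausdorff.ghDist (toeplitzSystem (n + 1)).State circleSystem.State)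
        atTop (𝓝 0) := by
  choose m hm htop using fun n : ℕ => exists_metricSpace_toeplitz n.succ_pos
  obtain ⟨m', hm', htop'⟩ := exists_metricSpace_circle
  have hne := nonempty_circleState
  have hneT : ∀ n : ℕ, Nonempty (toeplitzSystem (n + 1)).State :=
    fun n => hne.map (symbolState n.succ_pos)
  have hcT : ∀ n : ℕ, CompactSpace (toeplitzSystem (n + 1)).State := fun n => by
    rw [htop n]
    exact OperatorSystem.compactSpace_state _
  have hc : CompactSpace circleSystem.State := by
    rw [htop']
    exact OperatorSystem.compactSpace_state _
  refine ⟨m, m', hneT, hcT, hne, hc, hm, hm', htop, htop', ?_⟩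
  have hlim : Tendsto (fun n : ℕ => (√2 + 1) * fejerRate (n + 1)) atTop (𝓝 0) := by
    simpa using ((tendsto_add_atTop_iff_nat 1).2 tendsto_fejerRate).const_mul (√2 + 1)
  exact squeeze_zero (fun n => dist_nonneg) (fun n => ghDist_le n.succ_pos (hm n) hm') hlim
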